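/- **Theorem (Accuracy of explicit iteration schemes).** Let $Q\in\mathbb{R}^{d\times d}$ be symmetric, $V(y)=\tfrac12\langle y,Qy\rangle$, and let $S:\mathbb{R}^d\to\mathbb{R}^{d\times d}$ take skew-symmetric values. Let $y:[a,T)\to\mathbb{R}^d$, $a\le 0<T$, solve $\dot y=S(y)\nabla V(y)$, and put $y_0=y(0)$. Let $A=(a_{ij})\in\mathbb{R}^{s\times s}$ and $b\in\mathbb{R}^s$ define a Runge–Kutta method with abscissae $c_i=\sum_j a_{ij}$ (the base method); if some $c_i$ is negative, assume $a<0$ (otherwise $a=0$ is allowed). Given $h>0$, $k\ge 1$ and initial stages $Y^{(0)}_1,\dots,Y^{(0)}_s\in\mathbb{R}^d$, the *explicit iteration scheme with $k$ iterations* computes $$Y^{(l)}_i=y_0+h\sum_{j=1}^s a_{ij}S(Y^{(l-1)}_j)\nabla V(Y^{(l-1)}_j)\qquad(1\le l\le k-1),$$ then performs a semi-implicit step: it solves the linear system $$Y^{(k)}_i=y_0+h\sum_{j=1}^s a_{ij}S(Y^{(k-1)}_j)\nabla V(Y^{(k)}_j)\qquad(1\le i\le s)$$ and outputs $y^{(k)}_1=y_0+h\sum_{j=1}^s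 b_jS(Y^{(k-1)}_j)\nabla V(Y^{(k)}_j)$. Assume: * **(A2)** $S$ is Lipschitz continuous (Euclidean norm on $\mathbb{R}^d$, induced 2-norm on matrices) and, if $p\ge2$, also of class $C^{p-1}$ with locally Lipschitz derivative of order $p-1$ (for instance, of class $C^p$); * **(A3)** the base method has order $p$, i.e. for every $C^\infty$ autonomous system $\dot z=f(z)$ in finite dimension and every solution $z$ on an interval $[0,\tau)$, $\tau>0$, the Runge–Kutta solution $z_1$ after one step of size $h$ from $z(0)$, with stages near $z(0)$, satisfies $z_1-z(h)=O(h^{p+1})$ as $h\to0^+$. Then for every constant $C$ there are constants $C'$ and $h_0>0$, depending only on $y$, $k$, $S$, $Q$, $A$, $b$, $p$ and $C$, such that for all $0<h<h_0$, all integers $q\ge0$ and all $Y^{(0)}_1,\dots,Y^{(0)}_s$ with * **(A1)** $\|Y^{(0)}_i-y(c_ih)\|\le Ch^q$ for each $i$, the linear system of the semi-implicit step has exactly one solution and $$\|y^{(k)}_1-y(h)\|\le C'h^{\min\{p,\,q+k-1\}+1}.$$ Moreover, if the base method is canonical, i.e. $b_ia_{ij}+b_ja_{ji}=b_ib_j$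 for all $i,j$, then the quadratic invariant is conserved: for every step size $h$, all initial stages and every solution of the semi-implicit step, $V(y^{(k)}_1)=V(y_0)$. -/

import Mathlib

open scoped NNReal ContDiff

noncomputable section

namespace QuadInv

/-- `y` solves the autonomous equation `y' = f (y)` on the set `J` of times
(one-sided derivatives at end points that belong to `J`). -/
def IsSolutionOn {E : Type*} [NormedAddCommGroup E] [NormedSpace ℝ E]
    (f : E → E) (y : ℝ → E) (J : Set ℝ) : Prop :=
  ∀ t ∈ J, HasDerivWithinAt y (f (y t)) J t

section RungeKutta

variable {s : ℕ} {E : Type*} [NormedAddCommGroup E] [NormedSpace ℝ E]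

/-- The abscissae `c_i = ∑ j, a_ij` of a Runge-Kutta method. -/
def abscissa (A : Matrix (Fin s) (Fin s) ℝ) (i : Fin s) : ℝ := ∑ j, A i j

/-- `Y` is a family of inner stages of the Runge-Kutta method with matrix `A`, step `h` and
initial value `y₀` for `y' = f (y)`. -/
def IsRKStages (A : Matrix (Fin s) (Fin s) ℝ) (f : E → E) (y₀ : E) (h : ℝ)
    (Y : Fin s → E) : Prop :=
  ∀ i, Y i = y₀ + h • ∑ j, A i j • f (Y j)

/-- The value `y₁ = y₀ + h ∑ b_i f (Y_i)` computed from the inner stages `Y`. -/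
def rkStep (b : Fin s → ℝ) (f : E → E) (y₀ : E) (h : ℝ) (Y : Fin s → E) : E :=
  y₀ + h • ∑ i, b i • f (Y i)

/-- The Runge-Kutta method `(A, b)` has order (at least) `p`: for every smooth autonomous system
and every solution `y` of it, the numerical solution after one step from `y 0` satisfies
`y₁ - y h = O (h ^ (p + 1))` as `h` tends to `0` from the right.

The stage equations of an implicit method may have spurious solutions far away from `y 0` when
`f` is not globally Lipschitz; the numerical solution is the one whose stages are near `y 0`, which
is what the radius `r` expresses. -/
def HasOrder (A : Matrix (Fin s) (Fin s) ℝ) (b : Fin s → ℝ) (p : ℕ) : Prop :=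
  ∀ (E : Type) [NormedAddCommGroup E] [NormedSpace ℝ E] [FiniteDimensional ℝ E]
    (f : E → E) (y : ℝ → E) (T : ℝ),
    ContDiff ℝ ∞ f → 0 < T → IsSolutionOn f y (Set.Ico 0 T) →
    ∃ K r h₀ : ℝ, 0 < r ∧ 0 < h₀ ∧ ∀ h : ℝ, 0 < h → h < h₀ → ∀ Y : Fin s → E,
      IsRKStages A f (y 0) h Y → (∀ i, ‖Y i - y 0‖ ≤ r) →
      ‖rkStep b f (y 0) h Y - y h‖ ≤ K * h ^ (p + 1)

/-- Canonical Runge-Kutta methods. -/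
def IsCanonical (A : Matrix (Fin s) (Fin s) ℝ) (b : Fin s → ℝ) : Prop :=
  ∀ i j, b i * A i j + b j * A j i = b i * b j

end RungeKutta

section Scheme

variable {d s : ℕ}

/-- The quadratic function `V (y) = ⟨y, Q y⟩ / 2`. -/
def quadV (Q : EuclideanSpace ℝ (Fin d) →L[ℝ] EuclideanSpace ℝ (Fin d))
    (y : EuclideanSpace ℝ (Fin d)) : ℝ :=
  (1 / 2) * inner ℝ y (Q y)

/-- The iterates `Y^(k)` of the explicit update
`Y^(k+1)_i = y₀ + h ∑ j, a_ij S (Y^(k)_j) ∇V (Y^(k)_j)` started at `Y^(0) = Y₀`. -/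
def explicitIterate (A : Matrix (Fin s) (Fin s) ℝ)
    (S : EuclideanSpace ℝ (Fin d) → EuclideanSpace ℝ (Fin d) →L[ℝ] EuclideanSpace ℝ (Fin d))
    (V : EuclideanSpace ℝ (Fin d) → ℝ) (y₀ : EuclideanSpace ℝ (Fin d)) (h : ℝ)
    (Y₀ : Fin s → EuclideanSpace ℝ (Fin d)) : ℕ → Fin s → EuclideanSpace ℝ (Fin d)
  | 0 => Y₀
  | k + 1 => fun i => y₀ + h • ∑ j, A i j •
      S (explicitIterate A S V y₀ h Y₀ k j) (gradient V (explicitIterate A S V y₀ h Y₀ k j))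

/-- `Z` solves the semi-implicit (linear) stage equations
`Z_i = y₀ + h ∑ j, a_ij S (X_j) ∇V (Z_j)` with frozen argument `X`. -/
def IsSemiImplicitStages (A : Matrix (Fin s) (Fin s) ℝ)
    (S : EuclideanSpace ℝ (Fin d) → EuclideanSpace ℝ (Fin d) →L[ℝ] EuclideanSpace ℝ (Fin d))
    (V : EuclideanSpace ℝ (Fin d) → ℝ) (y₀ : EuclideanSpace ℝ (Fin d)) (h : ℝ)
    (X Z : Fin s → EuclideanSpace ℝ (Fin d)) : Prop :=
  ∀ i, Z i = y₀ + h • ∑ j, A i j • S (X j) (gradient V (Z j))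

/-- The output `y₀ + h ∑ j, b_j S (X_j) ∇V (Z_j)`. -/
def semiImplicitOutput (b : Fin s → ℝ)
    (S : EuclideanSpace ℝ (Fin d) → EuclideanSpace ℝ (Fin d) →L[ℝ] EuclideanSpace ℝ (Fin d))
    (V : EuclideanSpace ℝ (Fin d) → ℝ) (y₀ : EuclideanSpace ℝ (Fin d)) (h : ℝ)
    (X Z : Fin s → EuclideanSpace ℝ (Fin d)) : EuclideanSpace ℝ (Fin d) :=
  y₀ + h • ∑ j, b j • S (X j) (gradient V (Z j))

/-- `(Z, y₁)` is the result of the scheme with `k` iterations (`k ≥ 1`) with initial stages `Y₀`: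
`k - 1` explicit updates, then one semi-implicit step with stages `Z = Y^(k)`, whose output is
`y₁ = y₁^(k)`. -/
def IsExplicitScheme (A : Matrix (Fin s) (Fin s) ℝ) (b : Fin s → ℝ)
    (S : EuclideanSpace ℝ (Fin d) → EuclideanSpace ℝ (Fin d) →L[ℝ] EuclideanSpace ℝ (Fin d))
    (V : EuclideanSpace ℝ (Fin d) → ℝ) (y₀ : EuclideanSpace ℝ (Fin d)) (h : ℝ) (k : ℕ)
    (Y₀ Z : Fin s → EuclideanSpace ℝ (Fin d)) (y₁ : EuclideanSpace ℝ (Fin d)) : Prop :=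
  IsSemiImplicitStages A S V y₀ h (explicitIterate A S V y₀ h Y₀ (k - 1)) Z ∧
    y₁ = semiImplicitOutput b S V y₀ h (explicitIterate A S V y₀ h Y₀ (k - 1)) Z

end Scheme

end QuadInv

end

/-!
# Accuracy of explicit iteration schemes

Write `f x = S x (Q x)` for the vector field, so that the equation is `y' = f y`.

*Exact initial stages.* Suppose first that the initial stages are `y (c_i h)`. The scheme with
`m` explicit iterations and a final semi-implicit step is then one step of the base method for the
larger system `extendedField`: time `t`, a component driven by `S (y t) (Q (y t))`, a component
driven by the field at the component before it, and so on, the linear factor of the last component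
being driven by that component itself. All these components are solved by `y`, so the order of
the base method gives an error `O (h ^ (p + 1))` for every `m`
(`HasOrder.exists_eventually_exactStart`).

*Finite smoothness.* The order is defined by means of smooth systems, while `S` only has a locally
Lipschitz derivative of order `p - 1`. But `S` agrees with its Taylor polynomial at `y 0` up to
`O (‖x - y 0‖ ^ p)` (`exists_contDiff_sub_isBigO_pow`), and `y` with a smooth Picard iterate up to
`O (t ^ p)` (`exists_contDiff_curve_sub_isBigO_pow`). With these in place of `S` and `y` the
extended system is smooth, `y` solves it up to a defect `O (t ^ p)`, and the scheme satisfies its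
stage equations up to `O (h ^ p)` in the slopes. By Grönwall's inequality and the contraction
principle, such defects change the solution and the numerical solution by `O (h ^ (p + 1))`
(`HasOrder.of_defect`), so no order conditions on the coefficients are needed.

*Perturbed initial stages.* An error `O (h ^ q)` of the initial stages gains a factor `h` in each
explicit iteration and in the semi-implicit step, hence contributes `O (h ^ (q + m + 1))` to the
output (`HasOrder.exists_eventually_explicitScheme`).

*Conservation.* The slopes `S (X_i) (Q (Z_i))` are orthogonal to `Q (Z_i)`, after which the usual
computation for canonical methods applies (`quadV_semiImplicitOutput`).
-/

namespace QuadInv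

open Set Filter Topology Asymptotics

/-! ### Smooth approximation of the vector field and of the solution -/

section Approximation

variable {E F : Type*} [NormedAddCommGroup E] [NormedSpace ℝ E]
  [NormedAddCommGroup F] [NormedSpace ℝ F]

/-- A map of class `C^n` whose `n`-th derivative is locally Lipschitz agrees near each point with a
smooth map up to order `n + 1`. The smooth map is the Taylor polynomial of degree `n`. -/
theorem exists_contDiff_sub_isBigO_pow [CompleteSpace F] {n : ℕ} {f : E → F} (hf : ContDiff ℝ n f)
    (hL : LocallyLipschitz (iteratedFDeriv ℝ n f)) (x₀ : E) :
    ∃ g : E → F, ContDiff ℝ ∞ g ∧ (fun x => f x - g x) =O[𝓝 x₀] fun x => ‖x - x₀‖ ^ (n + 1) := by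
  obtain ⟨K, U, hU, hK⟩ := hL x₀
  obtain ⟨ε, hε, hεU⟩ := Metric.mem_nhds_iff.1 hU
  cases n with
  | zero =>
    refine ⟨fun _ => f x₀, contDiff_const, .of_bound K ?_⟩
    filter_upwards [hU] with x hx
    have h := hK.dist_le_mul x hx x₀ (mem_of_mem_nhds hU)
    have h2 : dist (iteratedFDeriv ℝ 0 f x) (iteratedFDeriv ℝ 0 f x₀) = dist (f x) (f x₀) := by
      simp only [iteratedFDeriv_zero_eq_comp, Function.comp]
      exact LinearIsometryEquiv.dist_map _ _ _
    rw [h2, dist_eq_norm, dist_eq_norm] at h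
    simpa using h
  | succ n =>
    -- the coefficient of the top term is kept in the form in which the integral remainder of order
    -- `n` produces it, so that only the increment of the top derivative is left to estimate
    set c : ℝ := ∫ t in (0 : ℝ)..1, (1 - t) ^ n with hc
    have hterm : ∀ k : ℕ, ContDiff ℝ ∞ fun x : E => iteratedFDeriv ℝ k f x₀ fun _ => x - x₀ :=
      fun k => (ContinuousMultilinearMap.contDiff _).comp
        (contDiff_pi.2 fun _ => contDiff_id.sub contDiff_const)
    refine ⟨fun x => ∑ k ∈ Finset.range (n + 1),
      ((k.factorial : ℝ))⁻¹ • (iteratedFDeriv ℝ k f x₀ fun _ => x - x₀) +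
        ((n.factorial : ℝ))⁻¹ • c • iteratedFDeriv ℝ (n + 1) f x₀ fun _ => x - x₀,
      ?_, .of_bound (((n.factorial : ℝ))⁻¹ * K) ?_⟩
    · exact (ContDiff.sum fun k _ => (hterm k).const_smul _).add
        (((hterm (n + 1)).const_smul c).const_smul _)
    filter_upwards [Metric.ball_mem_nhds x₀ hε] with x hx
    have hT := map_add_eq_sum_add_integral_iteratedFDeriv (f := f) (x := x₀) (y := x - x₀) (n := n)
      fun t _ => by exact_mod_cast hf.contDiffAt
    rw [add_sub_cancel] at hT
    have hcont : Continuous fun t : ℝ =>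
        iteratedFDeriv ℝ (n + 1) f (x₀ + t • (x - x₀)) fun _ => x - x₀ := by
      have h1 : Continuous fun t : ℝ => iteratedFDeriv ℝ (n + 1) f (x₀ + t • (x - x₀)) :=
        (hf.continuous_iteratedFDeriv le_rfl).comp (by fun_prop)
      exact h1.eval_const _
    have hpow : Continuous fun t : ℝ => (1 - t) ^ n := by fun_prop
    have hint : c • iteratedFDeriv ℝ (n + 1) f x₀ (fun _ => x - x₀) =
        ∫ t in (0 : ℝ)..1, (1 - t) ^ n • iteratedFDeriv ℝ (n + 1) f x₀ (fun _ => x - x₀) := by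
      rw [intervalIntegral.integral_smul_const]
    have hrem : f x - (∑ k ∈ Finset.range (n + 1),
        ((k.factorial : ℝ))⁻¹ • (iteratedFDeriv ℝ k f x₀ fun _ => x - x₀) +
          ((n.factorial : ℝ))⁻¹ • c • iteratedFDeriv ℝ (n + 1) f x₀ fun _ => x - x₀) =
        ((n.factorial : ℝ))⁻¹ • ∫ t in (0 : ℝ)..1, (1 - t) ^ n •
          ((iteratedFDeriv ℝ (n + 1) f (x₀ + t • (x - x₀)) fun _ => x - x₀) -
            iteratedFDeriv ℝ (n + 1) f x₀ fun _ => x - x₀) := by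
      simp only [smul_sub ((_ : ℝ) ^ n)]
      rw [hT, hint, intervalIntegral.integral_sub, smul_sub]
      · rw [add_sub_add_left_eq_sub]
      · exact (hpow.smul hcont).intervalIntegrable _ _
      · exact (hpow.smul continuous_const).intervalIntegrable _ _
    have hbound : ‖∫ t in (0 : ℝ)..1, (1 - t) ^ n •
          ((iteratedFDeriv ℝ (n + 1) f (x₀ + t • (x - x₀)) fun _ => x - x₀) -
            iteratedFDeriv ℝ (n + 1) f x₀ fun _ => x - x₀)‖ ≤
        K * ‖x - x₀‖ ^ (n + 2) * |(1 : ℝ) - 0| := by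
      refine intervalIntegral.norm_integral_le_of_norm_le_const fun t ht => ?_
      rw [uIoc_of_le zero_le_one] at ht
      have hxb : ‖x - x₀‖ < ε := by simpa [dist_eq_norm] using hx
      have htx : ‖t • (x - x₀)‖ ≤ ‖x - x₀‖ := by
        rw [norm_smul, Real.norm_of_nonneg ht.1.le]
        exact mul_le_of_le_one_left (norm_nonneg _) ht.2
      have hmem : x₀ + t • (x - x₀) ∈ Metric.ball x₀ ε := by
        rw [Metric.mem_ball, dist_eq_norm, add_sub_cancel_left]
        exact htx.trans_lt hxb
      have hd := hK.dist_le_mul _ (hεU hmem) _ (mem_of_mem_nhds hU)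
      rw [dist_eq_norm, dist_eq_norm, add_sub_cancel_left] at hd
      rw [← sub_apply, norm_smul, norm_pow,
        Real.norm_of_nonneg (by linarith [ht.2] : (0 : ℝ) ≤ 1 - t)]
      have h1 := ContinuousMultilinearMap.le_opNorm (iteratedFDeriv ℝ (n + 1) f
        (x₀ + t • (x - x₀)) - iteratedFDeriv ℝ (n + 1) f x₀) fun _ => x - x₀
      simp only [Finset.prod_const, Finset.card_univ, Fintype.card_fin] at h1
      have h2 : (1 - t) ^ n ≤ 1 := pow_le_one₀ (by linarith [ht.2]) (by linarith [ht.1])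
      refine (mul_le_of_le_one_left (norm_nonneg _) h2).trans (h1.trans ?_)
      calc _ ≤ (K * ‖x - x₀‖) * ‖x - x₀‖ ^ (n + 1) := by gcongr; exact hd.trans (by gcongr)
        _ = _ := by ring
    rw [hrem, norm_smul, norm_pow, norm_norm, Real.norm_of_nonneg (by positivity), mul_assoc]
    gcongr
    simpa using hbound

/-- If the derivative of `u` on an interval `J ∋ 0` is `O (t ^ n)` and `u 0 = 0`, then `u` is
`O (t ^ (n + 1))`. -/
theorem isBigO_pow_succ_of_hasDerivWithinAt {u u' : ℝ → F} {J : Set ℝ} (hJ : J.OrdConnected)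
    (h0 : (0 : ℝ) ∈ J) (hu0 : u 0 = 0) (hu : ∀ t ∈ J, HasDerivWithinAt u (u' t) J t) {n : ℕ}
    (hn : u' =O[𝓝[J] 0] fun t => t ^ n) : u =O[𝓝[J] 0] fun t => t ^ (n + 1) := by
  obtain ⟨c, hc0, hc⟩ := hn.exists_nonneg
  rw [isBigOWith_iff] at hc
  obtain ⟨ε, hε, hb⟩ := Metric.mem_nhdsWithin_iff.1 hc
  refine .of_bound c ?_
  refine Metric.mem_nhdsWithin_iff.2 ⟨ε, hε, fun t ⟨htε, htJ⟩ => ?_⟩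
  have hsub : uIcc 0 t ⊆ J := hJ.uIcc_subset h0 htJ
  have hle : ∀ x ∈ uIcc 0 t, |x| ≤ |t| := fun x hx => by
    simpa using abs_sub_left_of_mem_uIcc hx
  have hc1 : ∀ x ∈ uIcc 0 t, ‖u' x‖ ≤ c * |t| ^ n := fun x hx => by
    have hxε : x ∈ Metric.ball (0 : ℝ) ε := by
      rw [Metric.mem_ball, Real.dist_0_eq_abs] at htε ⊢
      exact (hle x hx).trans_lt htε
    have h1 : ‖u' x‖ ≤ c * ‖x ^ n‖ := hb ⟨hxε, hsub hx⟩
    rw [norm_pow, Real.norm_eq_abs] at h1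
    exact h1.trans (by gcongr ?_ * ?_ ^ n; exact hle x hx)
  have h2 := (convex_uIcc 0 t).norm_image_sub_le_of_norm_hasDerivWithin_le
    (fun x hx => (hu x (hsub hx)).mono hsub) hc1 left_mem_uIcc right_mem_uIcc
  rw [hu0, sub_zero, sub_zero, Real.norm_eq_abs, mul_assoc, ← pow_succ] at h2
  simpa using h2

/-- A solution of `y' = f y` agrees with a smooth curve up to order `p` as soon as `f` agrees with a
smooth vector field up to order `p`; the smooth curve is a Picard iterate. The set of times may have
`0` as an end point. -/
theorem exists_contDiff_curve_sub_isBigO_pow [CompleteSpace F] {f g : F → F} {y : ℝ → F} {J : Set ℝ}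
    (hJ : J.OrdConnected) (h0 : (0 : ℝ) ∈ J) (hy : IsSolutionOn f y J) (hg : ContDiff ℝ ∞ g)
    {p : ℕ} (hfg : (fun x => f x - g x) =O[𝓝 (y 0)] fun x => ‖x - y 0‖ ^ p) :
    ∃ P : ℝ → F, ContDiff ℝ ∞ P ∧ P 0 = y 0 ∧
      (fun t => y t - P t) =O[𝓝[J] 0] fun t => t ^ p := by
  have hyc : Tendsto y (𝓝[J] 0) (𝓝 (y 0)) := (hy 0 h0).continuousWithinAt
  have hyO : (fun t => y t - y 0) =O[𝓝[J] 0] fun t : ℝ => t := by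
    simpa [Function.comp_def] using (hy 0 h0).isBigO_sub
  have key : ∀ n ≤ p, ∃ P : ℝ → F, ContDiff ℝ ∞ P ∧ P 0 = y 0 ∧
      (fun t => y t - P t) =O[𝓝[J] 0] fun t => t ^ n := by
    intro n
    induction n with
    | zero =>
      intro _
      refine ⟨fun _ => y 0, contDiff_const, rfl, ?_⟩
      simp only [pow_zero]
      exact ((hyc.sub_const (y 0)).isBigO_one ℝ)
    | succ n ih =>
      intro hn
      obtain ⟨P, hP, hP0, hyP⟩ := ih (by omega)
      have hgP : ContDiff ℝ ∞ fun t => g (P t) := hg.comp hP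
      have hd : ∀ t, HasDerivAt (fun t => y 0 + ∫ s in (0 : ℝ)..t, g (P s)) (g (P t)) t :=
        fun t => (hgP.continuous.integral_hasStrictDerivAt 0 t).hasDerivAt.const_add _
      refine ⟨fun t => y 0 + ∫ s in (0 : ℝ)..t, g (P s), ?_, by simp, ?_⟩
      · refine contDiff_infty_iff_deriv.2 ⟨fun t => (hd t).differentiableAt, ?_⟩
        rw [funext fun t => (hd t).deriv]
        exact hgP
      refine isBigO_pow_succ_of_hasDerivWithinAt hJ h0 (by simp)
        (fun t ht => (hy t ht).sub (hd t).hasDerivWithinAt) ?_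
      have h1 : (fun t => f (y t) - g (y t)) =O[𝓝[J] 0] fun t => t ^ n := by
        refine (hfg.comp_tendsto hyc).trans (((hyO.norm_left).pow p).trans ?_)
        refine .of_bound 1 (nhdsWithin_le_nhds ?_)
        filter_upwards [Metric.ball_mem_nhds (0 : ℝ) one_pos] with t ht
        rw [Metric.mem_ball, Real.dist_0_eq_abs] at ht
        rw [norm_pow, norm_pow, one_mul, Real.norm_eq_abs]
        exact pow_le_pow_of_le_one (abs_nonneg t) ht.le (by omega)
      have hst := (hg.contDiffAt (x := y 0)).hasStrictFDerivAt (by simp)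
      have hPc : Tendsto P (𝓝[J] 0) (𝓝 (y 0)) := by
        rw [← hP0]; exact hP.continuous.continuousAt.tendsto.mono_left nhdsWithin_le_nhds
      have h2 : (fun t => g (y t) - g (P t)) =O[𝓝[J] 0] fun t => t ^ n :=
        (hst.isBigO_sub.comp_tendsto (hyc.prodMk_nhds hPc)).trans hyP
      simpa using h1.add h2
  exact key p le_rfl

end Approximation

/-! ### Stability of the order under perturbations -/

section Perturbation

variable {s : ℕ}

/-- A common bound for the absolute row sums of a Runge-Kutta matrix and of its weights. -/
def IsWeightBound (A : Matrix (Fin s) (Fin s) ℝ) (b : Fin s → ℝ) (α : ℝ) : Prop :=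
  0 ≤ α ∧ (∀ i, ∑ j, |A i j| ≤ α) ∧ ∑ j, |b j| ≤ α

theorem exists_isWeightBound (A : Matrix (Fin s) (Fin s) ℝ) (b : Fin s → ℝ) :
    ∃ α, IsWeightBound A b α := by
  refine ⟨(∑ i, ∑ j, |A i j|) + ∑ j, |b j|, by positivity, fun i => ?_, ?_⟩
  · have := Finset.single_le_sum (f := fun i => ∑ j, |A i j|)
      (fun i _ => Finset.sum_nonneg fun j _ => abs_nonneg _) (Finset.mem_univ i)
    have h2 : 0 ≤ ∑ j, |b j| := by positivity
    linarith
  · have : 0 ≤ ∑ i, ∑ j, |A i j| := by positivity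
    linarith

variable {E : Type*} [NormedAddCommGroup E] [NormedSpace ℝ E]

theorem norm_smul_sum_smul_le {c : Fin s → ℝ} {α h D : ℝ} (hc : ∑ j, |c j| ≤ α) (hh : 0 ≤ h)
    (hD : 0 ≤ D) {φ : Fin s → E} (hφ : ∀ j, ‖φ j‖ ≤ D) : ‖h • ∑ j, c j • φ j‖ ≤ h * α * D := by
  rw [norm_smul, Real.norm_of_nonneg hh, mul_assoc]
  gcongr
  calc _ ≤ ∑ j, |c j| * D := norm_sum_le_of_le _ fun j _ => by
        rw [norm_smul, Real.norm_eq_abs]; gcongr; exact hφ j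
    _ = (∑ j, |c j|) * D := by rw [Finset.sum_mul]
    _ ≤ _ := by gcongr

theorem norm_add_smul_sum_sub_le {c : Fin s → ℝ} {α h D : ℝ} (hc : ∑ j, |c j| ≤ α) (hh : 0 ≤ h)
    (hD : 0 ≤ D) (x : E) {φ ψ : Fin s → E} (hφ : ∀ j, ‖φ j - ψ j‖ ≤ D) :
    ‖(x + h • ∑ j, c j • φ j) - (x + h • ∑ j, c j • ψ j)‖ ≤ h * α * D := by
  rw [add_sub_add_left_eq_sub, ← smul_sub, ← Finset.sum_sub_distrib]
  simp only [← smul_sub]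
  exact norm_smul_sum_smul_le hc hh hD hφ

/-- For small steps the stage equations of a field that is Lipschitz near the initial value have a
solution there, by the contraction principle. -/
theorem exists_isRKStages [CompleteSpace E] {A : Matrix (Fin s) (Fin s) ℝ} {f : E → E} {x₀ : E}
    {α h ρ F : ℝ} {K : ℝ≥0} (hα : ∀ i, ∑ j, |A i j| ≤ α) (hh : 0 ≤ h) (hρ : 0 ≤ ρ)
    (hF : ∀ x ∈ Metric.closedBall x₀ ρ, ‖f x‖ ≤ F)
    (hK : LipschitzOnWith K f (Metric.closedBall x₀ ρ)) (h1 : h * α * F ≤ ρ)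
    (h2 : h * α * K ≤ 1 / 2) :
    ∃ Y, IsRKStages A f x₀ h Y ∧ ∀ i, ‖Y i - x₀‖ ≤ ρ := by
  have hF0 : 0 ≤ F := (norm_nonneg _).trans (hF x₀ (Metric.mem_closedBall_self hρ))
  set B : Set (Fin s → E) := Metric.closedBall (fun _ => x₀) ρ with hB
  have hmem : ∀ Y : Fin s → E, Y ∈ B ↔ ∀ i, Y i ∈ Metric.closedBall x₀ ρ := fun Y => by
    rw [hB, closedBall_pi _ hρ]; simp
  set Φ : (Fin s → E) → Fin s → E := fun Y i => x₀ + h • ∑ j, A i j • f (Y j) with hΦ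
  have hmaps : MapsTo Φ B B := fun Y hY => by
    rw [hmem] at hY ⊢
    intro i
    rw [mem_closedBall_iff_norm, hΦ, add_sub_cancel_left]
    exact (norm_smul_sum_smul_le (hα i) hh hF0 fun j => hF _ (hY j)).trans h1
  have hlip : LipschitzOnWith (1 / 2) Φ B := by
    refine LipschitzOnWith.of_dist_le_mul fun Y hY Z hZ => ?_
    rw [hmem] at hY hZ
    refine (dist_pi_le_iff (by positivity)).2 fun i => ?_
    rw [dist_eq_norm]
    calc _ ≤ h * α * (K * dist Y Z) :=
          norm_add_smul_sum_sub_le (hα i) hh (by positivity) _ fun j => by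
            rw [← dist_eq_norm]
            exact (hK.dist_le_mul _ (hY j) _ (hZ j)).trans (by gcongr; exact dist_le_pi_dist Y Z j)
      _ = h * α * K * dist Y Z := by ring
      _ ≤ 1 / 2 * dist Y Z := by gcongr
      _ = _ := by simp
  have hcontr : ContractingWith (1 / 2) (hmaps.restrict Φ B B) :=
    ⟨by rw [← NNReal.coe_lt_coe]; norm_num, hlip.mapsToRestrict hmaps⟩
  obtain ⟨Y, hYB, hY, -⟩ := hcontr.exists_fixedPoint' Metric.isClosed_closedBall.isComplete hmaps
    (Metric.mem_closedBall_self hρ) (edist_ne_top _ _)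
  refine ⟨Y, fun i => (congrFun hY i).symm, fun i => ?_⟩
  rw [← mem_closedBall_iff_norm]
  exact (hmem Y).1 hYB i

/-- Two curves with the same initial value, the first a solution of `x' = G x` and the second
one up to a defect `O (t ^ p)`, differ by `O (t ^ (p + 1))`. -/
theorem exists_norm_sub_le_pow_of_defect {G : E → E} {x w v : ℝ → E} {T : ℝ} {p : ℕ} (hT : 0 < T)
    {K : ℝ≥0} {U : Set E} (hU : U ∈ 𝓝 (w 0)) (hG : LipschitzOnWith K G U)
    (hx : IsSolutionOn G x (Ico 0 T)) (hx0 : x 0 = w 0)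
    (hw : ∀ t ∈ Ico 0 T, HasDerivWithinAt w (v t) (Ico 0 T) t)
    (hv : (fun t => v t - G (w t)) =O[𝓝[Ico 0 T] 0] fun t => t ^ p) :
    ∃ M h₀ : ℝ, 0 ≤ M ∧ 0 < h₀ ∧ ∀ h, 0 < h → h < h₀ → ‖x h - w h‖ ≤ M * h ^ (p + 1) := by
  have h0 : (0 : ℝ) ∈ Ico 0 T := ⟨le_rfl, hT⟩
  obtain ⟨c, hc0, hc⟩ := hv.exists_nonneg
  rw [isBigOWith_iff] at hc
  have hxU : ∀ᶠ t in 𝓝[Ico 0 T] 0, x t ∈ U :=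
    (hx 0 h0).continuousWithinAt (by rw [hx0]; exact hU)
  have hwU : ∀ᶠ t in 𝓝[Ico 0 T] 0, w t ∈ U := (hw 0 h0).continuousWithinAt hU
  obtain ⟨ε, hε, hb⟩ := Metric.mem_nhdsWithin_iff.1 (hc.and (hxU.and hwU))
  have hb' : ∀ t, 0 ≤ t → t < min ε T → ‖v t - G (w t)‖ ≤ c * ‖t ^ p‖ ∧ x t ∈ U ∧ w t ∈ U :=
    fun t ht0 ht => hb ⟨by
      rw [Metric.mem_ball, Real.dist_0_eq_abs, abs_of_nonneg ht0]
      exact ht.trans_le (min_le_left _ _), ht0, ht.trans_le (min_le_right _ _)⟩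
  -- a positive Lipschitz constant, since the Grönwall bound is a case distinction at zero
  set K' : ℝ≥0 := K + 1
  have hK' : (0 : ℝ) < K' := by positivity
  refine ⟨2 * c, min (min ε T) (1 / K'), by positivity, by positivity, fun h hh0 hh => ?_⟩
  have hhε : h < min ε T := hh.trans_le (min_le_left _ _)
  have hhT : h < T := hhε.trans_le (min_le_right _ _)
  have hsub : Icc 0 h ⊆ Ico 0 T := fun t ht => ⟨ht.1, ht.2.trans_lt hhT⟩
  have hright : ∀ t ∈ Ico 0 h, Ico 0 T ∈ 𝓝[≥] t := fun t ht =>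
    mem_of_superset (Ico_mem_nhdsGE (ht.2.trans hhT)) (Ico_subset_Ico_left ht.1)
  have hgron := dist_le_of_approx_trajectories_ODE_of_mem (v := fun _ => G) (s := fun _ => U)
    (K := K') (f := x) (g := w) (f' := fun t => G (x t)) (g' := v) (a := 0) (b := h) (εf := 0)
    (εg := c * h ^ p) (δ := 0)
    (fun t _ => hG.weaken (by simp [K']))
    (fun t ht => ((hx t (hsub ht)).continuousWithinAt).mono hsub)
    (fun t ht => (hx t (hsub (Ico_subset_Icc_self ht))).mono_of_mem_nhdsWithin (hright t ht))
    (fun t _ => by simp)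
    (fun t ht => (hb' t ht.1 (ht.2.trans hhε)).2.1)
    (fun t ht => ((hw t (hsub ht)).continuousWithinAt).mono hsub)
    (fun t ht => (hw t (hsub (Ico_subset_Icc_self ht))).mono_of_mem_nhdsWithin (hright t ht))
    (fun t ht => by
      rw [dist_eq_norm]
      refine (hb' t ht.1 (ht.2.trans hhε)).1.trans ?_
      rw [norm_pow, Real.norm_of_nonneg ht.1]
      have := ht.1
      have := ht.2.le
      gcongr)
    (fun t ht => (hb' t ht.1 (ht.2.trans hhε)).2.2)
    (by simp [hx0]) h ⟨hh0.le, le_rfl⟩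
  simp only [gronwallBound_of_K_ne_0 hK'.ne', dist_eq_norm, sub_zero, zero_mul, zero_add]
    at hgron
  have hKh : K' * h ≤ 1 := by
    have : h ≤ 1 / K' := (hh.trans_le (min_le_right _ _)).le
    rwa [le_div_iff₀ hK', mul_comm] at this
  have hexp : Real.exp (K' * h) - 1 ≤ 2 * (K' * h) := by
    have h1 := Real.abs_exp_sub_one_le (x := K' * h) (by rwa [abs_of_nonneg (by positivity)])
    rw [abs_of_nonneg (by positivity : (0 : ℝ) ≤ K' * h)] at h1
    exact (le_abs_self _).trans h1
  calc _ ≤ _ := hgron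
    _ ≤ c * h ^ p / K' * (2 * (K' * h)) := by gcongr
    _ = _ := by field_simp; ring

/-- The order of a Runge-Kutta method is stable under perturbations: `w` need only solve
`w' = G w` up to a defect `O (t ^ p)`, and the slopes `φ i` used in the stage equations need only
agree with `G (W i)` up to `O (h ^ p)`. Comparison with the exact solution and the exact stages of
the smooth system through `w 0` reduces this to the definition of the order. -/
theorem HasOrder.of_defect {A : Matrix (Fin s) (Fin s) ℝ} {b : Fin s → ℝ} {p : ℕ}
    (horder : HasOrder A b p) {X : Type} [NormedAddCommGroup X] [NormedSpace ℝ X]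
    [FiniteDimensional ℝ X] {G : X → X} (hG : ContDiff ℝ ∞ G) {w v : ℝ → X} {T : ℝ} (hT : 0 < T)
    (hw : ∀ t ∈ Ico 0 T, HasDerivWithinAt w (v t) (Ico 0 T) t)
    (hv : (fun t => v t - G (w t)) =O[𝓝[Ico 0 T] 0] fun t => t ^ p) {D : ℝ} (hD : 0 ≤ D) :
    ∃ M r h₀ : ℝ, 0 < r ∧ 0 < h₀ ∧ ∀ h, 0 < h → h < h₀ → ∀ W φ : Fin s → X,
      (∀ i, W i = w 0 + h • ∑ j, A i j • φ j) → (∀ i, ‖W i - w 0‖ ≤ r) →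
      (∀ i, ‖φ i - G (W i)‖ ≤ D * h ^ p) →
      ‖w 0 + h • ∑ j, b j • φ j - w h‖ ≤ M * h ^ (p + 1) := by
  have : CompleteSpace X := FiniteDimensional.complete ℝ X
  obtain ⟨α, hα0, hαA, hαb⟩ := exists_isWeightBound A b
  have hG1 : ContDiffAt ℝ 1 G (w 0) := hG.contDiffAt.of_le (by exact_mod_cast le_top)
  obtain ⟨K, U, hU, hK⟩ := hG1.exists_lipschitzOnWith
  obtain ⟨x, hx0, ε, hε, hx⟩ :=
    hG1.exists_forall_mem_closedBall_exists_eq_forall_mem_Ioo_hasDerivAt₀ 0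
  have hxsol : ∀ τ ≤ ε, IsSolutionOn G x (Ico 0 τ) := fun τ hτ t ht =>
    (hx t ⟨by linarith [ht.1], by linarith [ht.2]⟩).hasDerivWithinAt
  obtain ⟨K₁, r₁, h₁, hr₁, hh₁, hord⟩ := horder X G x ε hG hε (hxsol ε le_rfl)
  have hTε : Ico 0 (min ε T) ⊆ Ico 0 T := Ico_subset_Ico_right (min_le_right _ _)
  obtain ⟨M, h₂, hM, hh₂, hdef⟩ := exists_norm_sub_le_pow_of_defect (T := min ε T) (by positivity)
    hU hK (hxsol _ (min_le_left _ _)) hx0 (fun t ht => (hw t (hTε ht)).mono hTε)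
    (hv.mono (nhdsWithin_mono _ hTε))
  obtain ⟨ρ', hρ', hρU⟩ := Metric.nhds_basis_closedBall.mem_iff.1 hU
  set ρ := min ρ' r₁
  have hρ : 0 < ρ := lt_min hρ' hr₁
  have hKρ : LipschitzOnWith K G (Metric.closedBall (w 0) ρ) :=
    hK.mono ((Metric.closedBall_subset_closedBall (min_le_left _ _)).trans hρU)
  set F := ‖G (w 0)‖ + K * ρ
  have hF : ∀ x ∈ Metric.closedBall (w 0) ρ, ‖G x‖ ≤ F := fun x hx => by
    have h1 := hKρ.dist_le_mul x hx (w 0) (Metric.mem_closedBall_self hρ.le)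
    have h2 : (K : ℝ) * dist x (w 0) ≤ K * ρ := by gcongr; exact hx
    have h3 : ‖G x‖ ≤ ‖G (w 0)‖ + ‖G x - G (w 0)‖ := norm_le_insert' _ _
    rw [dist_eq_norm] at h1
    linarith
  have hF0 : 0 ≤ F := by positivity
  obtain ⟨h₃, hh₃, hsmall⟩ : ∃ h₃ : ℝ, 0 < h₃ ∧ ∀ h, 0 ≤ h → h < h₃ →
      h * α * F ≤ ρ ∧ h * α * K ≤ 1 / 2 := by
    have hc1 : Tendsto (fun h : ℝ => h * α * F) (𝓝 0) (𝓝 0) := by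
      have : Continuous fun h : ℝ => h * α * F := by fun_prop
      simpa using this.tendsto 0
    have hc2 : Tendsto (fun h : ℝ => h * α * K) (𝓝 0) (𝓝 0) := by
      have : Continuous fun h : ℝ => h * α * K := by fun_prop
      simpa using this.tendsto 0
    obtain ⟨δ, hδ, hb⟩ := Metric.mem_nhds_iff.1
      ((hc1.eventually_le_const hρ).and (hc2.eventually_le_const (by norm_num : (0 : ℝ) < 1 / 2)))
    exact ⟨δ, hδ, fun h hh0 hh => hb (by simpa [abs_of_nonneg hh0] using hh)⟩
  refine ⟨2 * α * D + K₁ + M, ρ, min (min h₁ h₂) h₃, hρ, by positivity,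
    fun h hh0 hh W φ hW hWr hφ => ?_⟩
  have hlt₁ : h < h₁ := hh.trans_le ((min_le_left _ _).trans (min_le_left _ _))
  have hlt₂ : h < h₂ := hh.trans_le ((min_le_left _ _).trans (min_le_right _ _))
  obtain ⟨hs1, hs2⟩ := hsmall h hh0.le (hh.trans_le (min_le_right _ _))
  obtain ⟨Y, hY, hYρ⟩ := exists_isRKStages hαA hh0.le hρ.le hF hKρ hs1 hs2
  have hslope : ∀ j, ‖φ j - G (Y j)‖ ≤ D * h ^ p + K * ‖W - Y‖ := fun j => by
    have h1 := hKρ.dist_le_mul (W j) (mem_closedBall_iff_norm.2 (hWr j)) (Y j)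
      (mem_closedBall_iff_norm.2 (hYρ j))
    rw [dist_eq_norm, dist_eq_norm] at h1
    have h2 : ‖W j - Y j‖ ≤ ‖W - Y‖ := norm_le_pi_norm (W - Y) j
    have h3 : (K : ℝ) * ‖W j - Y j‖ ≤ K * ‖W - Y‖ := by gcongr
    have h4 := norm_sub_le_norm_sub_add_norm_sub (φ j) (G (W j)) (G (Y j))
    linarith [hφ j]
  have hE0 : 0 ≤ D * h ^ p + K * ‖W - Y‖ := by positivity
  have hE : ‖W - Y‖ ≤ h * α * (D * h ^ p + K * ‖W - Y‖) :=
    (pi_norm_le_iff_of_nonneg (by positivity)).2 fun i => by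
      rw [Pi.sub_apply, hW i, hY i]
      exact norm_add_smul_sum_sub_le (hαA i) hh0.le hE0 _ hslope
  have hout := norm_add_smul_sum_sub_le hαb hh0.le hE0 (w 0) hslope
  have hrk := hord h hh0 hlt₁ Y (by rw [hx0]; exact hY) fun i => by
    rw [hx0]; exact (hYρ i).trans (min_le_right _ _)
  rw [hx0] at hrk
  have hxw := hdef h hh0 hlt₂
  have habs : h * α * K * ‖W - Y‖ ≤ 1 / 2 * ‖W - Y‖ := by gcongr
  have htri : ‖w 0 + h • ∑ j, b j • φ j - w h‖ ≤
      ‖w 0 + h • ∑ j, b j • φ j - (w 0 + h • ∑ j, b j • G (Y j))‖ +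
        ‖rkStep b G (w 0) h Y - x h‖ + ‖x h - w h‖ := by
    refine (norm_sub_le_norm_sub_add_norm_sub _ (x h) _).trans ?_
    gcongr
    exact norm_sub_le_norm_sub_add_norm_sub _ _ _
  have hpow : (2 * α * D + K₁ + M) * h ^ (p + 1) =
      2 * (h * α * (D * h ^ p)) + K₁ * h ^ (p + 1) + M * h ^ (p + 1) := by ring
  rw [mul_add] at hE hout
  linarith

end Perturbation

/-! ### Conservation of the quadratic invariant -/

section Invariant

variable {d s : ℕ}

theorem gradient_quadV {Q : EuclideanSpace ℝ (Fin d) →L[ℝ] EuclideanSpace ℝ (Fin d)}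
    (hQ : IsSelfAdjoint Q) (x : EuclideanSpace ℝ (Fin d)) : gradient (quadV Q) x = Q x := by
  refine HasGradientAt.gradient ?_
  rw [hasGradientAt_iff_hasFDerivAt]
  have h := ((hasFDerivAt_id (𝕜 := ℝ) x).inner ℝ Q.hasFDerivAt).const_mul (1 / 2 : ℝ)
  refine h.congr_fderiv ?_
  ext v
  have hs : inner ℝ (Q x) v = inner ℝ x (Q v) := hQ.isSymmetric x v
  have hc : inner ℝ v (Q x) = inner ℝ (Q x) v := real_inner_comm _ _
  simp only [id, FunLike.coe_smul, Pi.smul_apply, ContinuousLinearMap.comp_apply,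
    ContinuousLinearMap.prod_apply, ContinuousLinearMap.id_apply, fderivInnerCLM_apply, smul_eq_mul,
    InnerProductSpace.toDual_apply_apply, hc, hs]
  ring

/-- Canonical methods conserve `V`: the slopes `S (X i) (Q (Z i))` are orthogonal to `Q (Z i)` by
skew-symmetry, and the terms quadratic in the step size cancel by the condition on the
coefficients. -/
theorem quadV_semiImplicitOutput {A : Matrix (Fin s) (Fin s) ℝ} {b : Fin s → ℝ}
    (hcan : IsCanonical A b)
    {S : EuclideanSpace ℝ (Fin d) → EuclideanSpace ℝ (Fin d) →L[ℝ] EuclideanSpace ℝ (Fin d)}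
    (hskew : ∀ x, ContinuousLinearMap.adjoint (S x) = -S x)
    {Q : EuclideanSpace ℝ (Fin d) →L[ℝ] EuclideanSpace ℝ (Fin d)} (hQ : IsSelfAdjoint Q)
    {y₀ : EuclideanSpace ℝ (Fin d)} {h : ℝ} {X Z : Fin s → EuclideanSpace ℝ (Fin d)}
    (hZ : IsSemiImplicitStages A S (quadV Q) y₀ h X Z) :
    quadV Q (semiImplicitOutput b S (quadV Q) y₀ h X Z) = quadV Q y₀ := by
  have hs : ∀ x z, inner ℝ (Q x) z = inner ℝ x (Q z) := hQ.isSymmetric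
  simp only [IsSemiImplicitStages, gradient_quadV hQ] at hZ
  simp only [semiImplicitOutput, gradient_quadV hQ]
  set φ := fun j => S (X j) (Q (Z j)) with hφ
  have horth : ∀ i, inner ℝ (φ i) (Q (Z i)) = 0 := fun i => by
    have h1 := ContinuousLinearMap.adjoint_inner_left (S (X i)) (Q (Z i)) (Q (Z i))
    rw [hskew, neg_apply, inner_neg_left] at h1
    simp only [hφ]
    linarith [real_inner_comm (S (X i) (Q (Z i))) (Q (Z i))]
  have hsymm : ∀ i j, inner ℝ (φ i) (Q (φ j)) = inner ℝ (φ j) (Q (φ i)) := fun i j => by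
    rw [← hs, real_inner_comm]
  have hstage : ∀ i, inner ℝ (φ i) (Q y₀) = -(h * ∑ j, A i j * inner ℝ (φ i) (Q (φ j))) :=
    fun i => by
      have h1 := horth i
      rw [hZ i, map_add, map_smul, map_sum, inner_add_right, inner_smul_right, inner_sum] at h1
      simp only [map_smul, inner_smul_right] at h1
      linarith
  have hlin : inner ℝ (∑ j, b j • φ j) (Q y₀) =
      -(h * ∑ i, ∑ j, b i * A i j * inner ℝ (φ i) (Q (φ j))) := by
    rw [sum_inner, Finset.mul_sum, ← Finset.sum_neg_distrib]
    refine Finset.sum_congr rfl fun i _ => ?_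
    rw [real_inner_smul_left, hstage]
    simp only [mul_assoc, ← Finset.mul_sum]
    ring
  have hquad : inner ℝ (∑ j, b j • φ j) (Q (∑ j, b j • φ j)) =
      ∑ i, ∑ j, b i * b j * inner ℝ (φ i) (Q (φ j)) := by
    simp only [map_sum, map_smul, sum_inner, inner_sum, real_inner_smul_left,
      real_inner_smul_right, mul_assoc]
    exact Finset.sum_congr rfl fun i _ => Finset.sum_congr rfl fun j _ => by rw [hsymm j i]
  have hcoef : 2 * ∑ i, ∑ j, b i * A i j * inner ℝ (φ i) (Q (φ j)) =
      ∑ i, ∑ j, b i * b j * inner ℝ (φ i) (Q (φ j)) := by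
    rw [two_mul]
    nth_rewrite 2 [Finset.sum_comm]
    simp only [← Finset.sum_add_distrib]
    refine Finset.sum_congr rfl fun i _ => Finset.sum_congr rfl fun j _ => ?_
    rw [hsymm j i, ← add_mul, hcan i j]
  have hcross : inner ℝ y₀ (Q (∑ j, b j • φ j)) = inner ℝ (∑ j, b j • φ j) (Q y₀) := by
    rw [← hs, real_inner_comm]
  rw [← hcoef] at hquad
  simp only [quadV]
  rw [map_add, map_smul, inner_add_left, inner_add_right, inner_add_right, real_inner_smul_left,
    real_inner_smul_left, real_inner_smul_right, real_inner_smul_right, hcross, hquad, hlin]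
  ring

end Invariant

/-! ### Stability of the iterations and of the semi-implicit step -/

section Stability

variable {d s : ℕ} {A : Matrix (Fin s) (Fin s) ℝ} {b : Fin s → ℝ}
  {S : EuclideanSpace ℝ (Fin d) → EuclideanSpace ℝ (Fin d) →L[ℝ] EuclideanSpace ℝ (Fin d)}
  {V : EuclideanSpace ℝ (Fin d) → ℝ}
  {Q : EuclideanSpace ℝ (Fin d) →L[ℝ] EuclideanSpace ℝ (Fin d)}
  {y₀ : EuclideanSpace ℝ (Fin d)} {α h R : ℝ}

theorem norm_apply_apply_sub_le {L : ℝ≥0} (hLip : LipschitzWith L S)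
    {x x' : EuclideanSpace ℝ (Fin d)} {β : ℝ} (hβ : ‖S x'‖ * ‖Q‖ ≤ β)
    (z z' : EuclideanSpace ℝ (Fin d)) :
    ‖S x (Q z) - S x' (Q z')‖ ≤ L * ‖Q‖ * ‖z‖ * ‖x - x'‖ + β * ‖z - z'‖ := by
  have hsplit : S x (Q z) - S x' (Q z') = (S x - S x') (Q z) + S x' (Q (z - z')) := by
    simp [map_sub]
  have h1 : ‖S x - S x'‖ ≤ L * ‖x - x'‖ := by
    simpa [dist_eq_norm] using hLip.dist_le_mul x x'
  rw [hsplit]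
  refine (norm_add_le _ _).trans (add_le_add ?_ ?_)
  · calc _ ≤ ‖S x - S x'‖ * (‖Q‖ * ‖z‖) := (S x - S x').le_opNorm_of_le (Q.le_opNorm z)
      _ ≤ (L * ‖x - x'‖) * (‖Q‖ * ‖z‖) := by gcongr
      _ = _ := by ring
  · calc _ ≤ ‖S x'‖ * (‖Q‖ * ‖z - z'‖) := (S x').le_opNorm_of_le (Q.le_opNorm _)
      _ = ‖S x'‖ * ‖Q‖ * ‖z - z'‖ := by ring
      _ ≤ _ := by gcongr

theorem norm_apply_mul_norm_le {L : ℝ≥0} (hLip : LipschitzWith L S)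
    {x : EuclideanSpace ℝ (Fin d)} (hx : ‖x - y₀‖ ≤ R) :
    ‖S x‖ * ‖Q‖ ≤ (‖S y₀‖ + L * R) * ‖Q‖ := by
  have h1 : ‖S x - S y₀‖ ≤ L * ‖x - y₀‖ := by
    simpa [dist_eq_norm] using hLip.dist_le_mul x y₀
  gcongr
  calc _ ≤ ‖S y₀‖ + ‖S x - S y₀‖ := norm_le_insert' _ _
    _ ≤ ‖S y₀‖ + L * ‖x - y₀‖ := by gcongr
    _ ≤ _ := by gcongr

theorem norm_explicitIterate_sub_le (hV : ∀ x, gradient V x = Q x)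
    (hα : ∀ i, ∑ j, |A i j| ≤ α) (hh : 0 ≤ h) {F R₀ : ℝ} (hF0 : 0 ≤ F)
    (hF : ∀ x, ‖x - y₀‖ ≤ R₀ → ‖S x (Q x)‖ ≤ F) (hhF : h * α * F ≤ R₀)
    {Y₀ : Fin s → EuclideanSpace ℝ (Fin d)} (hY₀ : ∀ i, ‖Y₀ i - y₀‖ ≤ R₀) (l : ℕ) (i : Fin s) :
    ‖explicitIterate A S V y₀ h Y₀ l i - y₀‖ ≤ R₀ := by
  induction l generalizing i with
  | zero => exact hY₀ i
  | succ l ih =>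
    simp only [explicitIterate, hV, add_sub_cancel_left]
    exact (norm_smul_sum_smul_le (hα i) hh hF0 fun j => hF _ (ih j)).trans hhF

theorem norm_explicitIterate_sub_explicitIterate_le (hV : ∀ x, gradient V x = Q x)
    (hα0 : 0 ≤ α) (hα : ∀ i, ∑ j, |A i j| ≤ α) (hh : 0 ≤ h) {Λ D : ℝ} (hΛ0 : 0 ≤ Λ) (hD : 0 ≤ D)
    (hΛ : ∀ x x', ‖x - y₀‖ ≤ R → ‖x' - y₀‖ ≤ R → ‖S x (Q x) - S x' (Q x')‖ ≤ Λ * ‖x - x'‖)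
    {Y Y' : Fin s → EuclideanSpace ℝ (Fin d)} (hYY' : ∀ i, ‖Y i - Y' i‖ ≤ D)
    (hY : ∀ l i, ‖explicitIterate A S V y₀ h Y l i - y₀‖ ≤ R)
    (hY' : ∀ l i, ‖explicitIterate A S V y₀ h Y' l i - y₀‖ ≤ R) (l : ℕ) (i : Fin s) :
    ‖explicitIterate A S V y₀ h Y l i - explicitIterate A S V y₀ h Y' l i‖ ≤
      (h * α * Λ) ^ l * D := by
  induction l generalizing i with
  | zero => simpa [explicitIterate] using hYY' i
  | succ l ih =>
    simp only [explicitIterate, hV]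
    refine (norm_add_smul_sum_sub_le (D := Λ * ((h * α * Λ) ^ l * D)) (hα i) hh (by positivity) _
      fun j => ?_).trans_eq (by ring)
    exact (hΛ _ _ (hY l j) (hY' l j)).trans (by gcongr; exact ih j)

/-- For small steps the linear system of the semi-implicit step is a contraction. -/
theorem existsUnique_isSemiImplicitStages (hV : ∀ x, gradient V x = Q x)
    (hα : ∀ i, ∑ j, |A i j| ≤ α) (hh : 0 ≤ h) {β : ℝ} (hβ0 : 0 ≤ β)
    {X : Fin s → EuclideanSpace ℝ (Fin d)} (hX : ∀ j, ‖S (X j)‖ * ‖Q‖ ≤ β)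
    (hhβ : h * α * β ≤ 1 / 2) : ∃! Z, IsSemiImplicitStages A S V y₀ h X Z := by
  set Φ : (Fin s → EuclideanSpace ℝ (Fin d)) → Fin s → EuclideanSpace ℝ (Fin d) :=
    fun Z i => y₀ + h • ∑ j, A i j • S (X j) (Q (Z j)) with hΦ
  have hlip : LipschitzWith (1 / 2) Φ := by
    refine LipschitzWith.of_dist_le_mul fun Z Z' => (dist_pi_le_iff (by positivity)).2 fun i => ?_
    rw [dist_eq_norm]
    calc _ ≤ h * α * (β * dist Z Z') :=
          norm_add_smul_sum_sub_le (hα i) hh (by positivity) _ fun j => by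
            rw [← map_sub, ← map_sub]
            calc _ ≤ ‖S (X j)‖ * (‖Q‖ * ‖Z j - Z' j‖) := (S (X j)).le_opNorm_of_le (Q.le_opNorm _)
              _ = ‖S (X j)‖ * ‖Q‖ * ‖Z j - Z' j‖ := by ring
              _ ≤ _ := by
                gcongr
                · exact hX j
                · rw [← dist_eq_norm]; exact dist_le_pi_dist Z Z' j
      _ = h * α * β * dist Z Z' := by ring
      _ ≤ 1 / 2 * dist Z Z' := by gcongr
      _ = _ := by simp
  have hcontr : ContractingWith (1 / 2) Φ := ⟨by rw [← NNReal.coe_lt_coe]; norm_num, hlip⟩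
  have hiff : ∀ Z, IsSemiImplicitStages A S V y₀ h X Z ↔ Φ Z = Z := fun Z => by
    simp only [IsSemiImplicitStages, hV, funext_iff, hΦ, eq_comm]
  simp only [hiff]
  exact ⟨hcontr.fixedPoint Φ, hcontr.fixedPoint_isFixedPt,
    fun Z hZ => hcontr.fixedPoint_unique hZ⟩

theorem norm_isSemiImplicitStages_sub_le (hV : ∀ x, gradient V x = Q x)
    (hα0 : 0 ≤ α) (hα : ∀ i, ∑ j, |A i j| ≤ α) (hh : 0 ≤ h) {β : ℝ} (hβ0 : 0 ≤ β)
    {X Z : Fin s → EuclideanSpace ℝ (Fin d)} (hX : ∀ j, ‖S (X j)‖ * ‖Q‖ ≤ β)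
    (hhβ : h * α * β ≤ 1 / 2) (hZ : IsSemiImplicitStages A S V y₀ h X Z) (i : Fin s) :
    ‖Z i - y₀‖ ≤ h * (2 * α * β * ‖y₀‖) := by
  set N := ‖Z - fun _ => y₀‖
  have hN : ∀ j, ‖Z j - y₀‖ ≤ N := norm_le_pi_norm (Z - fun _ => y₀)
  have hle : N ≤ h * α * (β * (‖y₀‖ + N)) :=
    (pi_norm_le_iff_of_nonneg (by positivity)).2 fun i => by
      have h1 := hZ i
      simp only [hV] at h1
      rw [Pi.sub_apply, h1, add_sub_cancel_left]
      refine norm_smul_sum_smul_le (hα i) hh (by positivity) fun j => ?_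
      calc _ ≤ ‖S (X j)‖ * (‖Q‖ * ‖Z j‖) := (S (X j)).le_opNorm_of_le (Q.le_opNorm _)
        _ = ‖S (X j)‖ * ‖Q‖ * ‖Z j‖ := by ring
        _ ≤ _ := by
          gcongr
          · exact hX j
          · exact (norm_le_insert' _ _).trans (by gcongr; exact hN j)
  have h2 : h * α * β * N ≤ 1 / 2 * N := by gcongr
  have h3 : h * α * (β * (‖y₀‖ + N)) = h * α * β * ‖y₀‖ + h * α * β * N := by ring
  have h4 : h * (2 * α * β * ‖y₀‖) = 2 * (h * α * β * ‖y₀‖) := by ring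
  linarith [hN i]

/-- Perturbing the frozen arguments of the semi-implicit step by `D` changes its output by
`O (h * D)`. -/
theorem norm_semiImplicitOutput_sub_le (hV : ∀ x, gradient V x = Q x) {L : ℝ≥0}
    (hLip : LipschitzWith L S) (hα0 : 0 ≤ α) (hαA : ∀ i, ∑ j, |A i j| ≤ α)
    (hαb : ∑ j, |b j| ≤ α) (hh : 0 ≤ h) {β D N : ℝ} (hβ0 : 0 ≤ β) (hD : 0 ≤ D) (hN : 0 ≤ N)
    {X X' Z Z' : Fin s → EuclideanSpace ℝ (Fin d)} (hX' : ∀ j, ‖S (X' j)‖ * ‖Q‖ ≤ β)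
    (hhβ : h * α * β ≤ 1 / 2) (hZ : IsSemiImplicitStages A S V y₀ h X Z)
    (hZ' : IsSemiImplicitStages A S V y₀ h X' Z') (hXX' : ∀ j, ‖X j - X' j‖ ≤ D)
    (hZN : ∀ j, ‖Z j‖ ≤ N) :
    ‖semiImplicitOutput b S V y₀ h X Z - semiImplicitOutput b S V y₀ h X' Z'‖ ≤
      2 * α * L * ‖Q‖ * N * (h * D) := by
  have hslope : ∀ j, ‖S (X j) (Q (Z j)) - S (X' j) (Q (Z' j))‖ ≤
      L * ‖Q‖ * N * D + β * ‖Z - Z'‖ := fun j => by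
    refine (norm_apply_apply_sub_le hLip (hX' j) _ _).trans ?_
    gcongr
    · exact hZN j
    · exact hXX' j
    · exact norm_le_pi_norm (Z - Z') j
  have hE0 : 0 ≤ L * ‖Q‖ * N * D + β * ‖Z - Z'‖ := by positivity
  have hE : ‖Z - Z'‖ ≤ h * α * (L * ‖Q‖ * N * D + β * ‖Z - Z'‖) :=
    (pi_norm_le_iff_of_nonneg (by positivity)).2 fun i => by
      have h1 := hZ i
      have h2 := hZ' i
      simp only [hV] at h1 h2
      rw [Pi.sub_apply, h1, h2]
      exact norm_add_smul_sum_sub_le (hαA i) hh hE0 _ hslope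
  have hout := norm_add_smul_sum_sub_le hαb hh hE0 y₀ hslope
  simp only [semiImplicitOutput, hV]
  have habs : h * α * β * ‖Z - Z'‖ ≤ 1 / 2 * ‖Z - Z'‖ := by gcongr
  have hexp : 2 * α * L * ‖Q‖ * N * (h * D) = 2 * (h * α * (L * ‖Q‖ * N * D)) := by ring
  rw [mul_add] at hE hout
  linarith

end Stability

/-! ### The extended system and exact initial stages -/

section Extended

variable {E : Type*} {m : ℕ}

/-- The frozen arguments of the components of the extended system: the `l`-th component is driven
by the component before it, the component `0` by the external datum `x`. -/
def frozenArg (x : E) (u : Fin (m + 1) → E) (l : Fin (m + 1)) : E :=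
  Fin.cases x (fun j : Fin m => u j.castSucc) l

/-- The arguments of the linear factor: the frozen ones, except that the last component, which
stands for the semi-implicit step, is driven by itself. -/
def activeArg (x : E) (u : Fin (m + 1) → E) (l : Fin (m + 1)) : E :=
  if l = Fin.last m then u l else frozenArg x u l

theorem frozenArg_zero (x : E) (u : Fin (m + 1) → E) : frozenArg x u 0 = x := rfl

theorem frozenArg_succ (x : E) (u : Fin (m + 1) → E) (j : Fin m) :
    frozenArg x u j.succ = u j.castSucc := rfl

/-- A family indexed by the components, whose frozen arguments are a given sequence, recovers the
sequence, up to the external datum. -/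
theorem dist_frozenArg_le [PseudoMetricSpace E] (x : E) (X : ℕ → E) (z : E) (l : Fin (m + 1)) :
    dist (X l) (frozenArg x (fun l : Fin (m + 1) => if l = Fin.last m then z else X (l + 1)) l) ≤
      dist (X 0) x := by
  refine Fin.cases (by simp [frozenArg_zero]) (fun j => ?_) l
  rw [frozenArg_succ, if_neg (Fin.castSucc_lt_last j).ne]
  simp

variable [NormedAddCommGroup E] [NormedSpace ℝ E]

/-- The extended system `t' = 1`, `u_l' = S (u_{l-1}) Q u_{l-1}` for `l < m` and
`u_m' = S (u_{m-1}) Q u_m`, with `u_{-1} = P t`. If `P` solves `y' = S y Q y` then so do all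
components that start at `P 0`, and a Runge-Kutta step for the extended system performs the `m`
explicit iterations and the semi-implicit step in one go. -/
def extendedField (S : E → E →L[ℝ] E) (Q : E →L[ℝ] E) (P : ℝ → E)
    (w : ℝ × (Fin (m + 1) → E)) : ℝ × (Fin (m + 1) → E) :=
  (1, fun l => S (frozenArg (P w.1) w.2 l) (Q (activeArg (P w.1) w.2 l)))

theorem contDiff_extendedField {S : E → E →L[ℝ] E} (hS : ContDiff ℝ ∞ S) (Q : E →L[ℝ] E)
    {P : ℝ → E} (hP : ContDiff ℝ ∞ P) : ContDiff ℝ ∞ (extendedField (m := m) S Q P) := by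
  have hfrozen : ∀ l : Fin (m + 1), ContDiff ℝ ∞
      fun w : ℝ × (Fin (m + 1) → E) => frozenArg (P w.1) w.2 l := fun l => by
    refine Fin.cases ?_ (fun j => ?_) l
    · exact hP.comp contDiff_fst
    · exact (contDiff_apply ℝ E j.castSucc).comp contDiff_snd
  have hactive : ∀ l : Fin (m + 1), ContDiff ℝ ∞
      fun w : ℝ × (Fin (m + 1) → E) => activeArg (P w.1) w.2 l := fun l => by
    unfold activeArg
    split_ifs
    · exact (contDiff_apply ℝ E l).comp contDiff_snd
    · exact hfrozen l
  exact contDiff_const.prodMk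
    (contDiff_pi.2 fun l => (hS.comp (hfrozen l)).clm_apply (Q.contDiff.comp (hactive l)))

/-- The error of replacing `S` by an approximation `S'` of order `p` near `y₀` and of
perturbing the arguments at the same time. -/
theorem exists_norm_apply_sub_apply_le {S S' : E → E →L[ℝ] E} (Q : E →L[ℝ] E) {y₀ : E} {p : ℕ}
    (hS' : ContDiff ℝ ∞ S') (h : (fun x => S x - S' x) =O[𝓝 y₀] fun x => ‖x - y₀‖ ^ p) :
    ∃ K r : ℝ, 0 ≤ K ∧ 0 < r ∧ ∀ x x' z z', ‖x - y₀‖ ≤ r → ‖x' - y₀‖ ≤ r → ‖z - y₀‖ ≤ r →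
      ‖S x (Q z) - S' x' (Q z')‖ ≤ K * (‖x - y₀‖ ^ p + ‖x - x'‖ + ‖z - z'‖) := by
  obtain ⟨c, hc0, hc⟩ := h.exists_nonneg
  rw [isBigOWith_iff] at hc
  obtain ⟨K₁, U, hU, hK₁⟩ :=
    (hS'.contDiffAt (x := y₀)).of_le (n := ∞) (m := 1) (by exact_mod_cast le_top)
      |>.exists_lipschitzOnWith
  obtain ⟨r, hr, hrb⟩ := Metric.nhds_basis_closedBall.mem_iff.1 (inter_mem hc hU)
  have hmem : ∀ x, ‖x - y₀‖ ≤ min r 1 →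
      ‖S x - S' x‖ ≤ c * ‖x - y₀‖ ^ p ∧ x ∈ U := fun x hx => by
    have h1 := hrb (mem_closedBall_iff_norm.2 (hx.trans (min_le_left _ _)))
    refine ⟨?_, h1.2⟩
    have h2 : ‖S x - S' x‖ ≤ c * ‖‖x - y₀‖ ^ p‖ := h1.1
    simpa using h2
  set N := ‖y₀‖ + 1
  refine ⟨c * ‖Q‖ * N + K₁ * ‖Q‖ * N + (‖S' y₀‖ + K₁) * ‖Q‖, min r 1, by positivity, by positivity,
    fun x x' z z' hx hx' hz => ?_⟩
  have hzN : ‖z‖ ≤ N := (norm_le_insert' z y₀).trans (by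
    simp only [N]; gcongr; exact hz.trans (min_le_right _ _))
  have hSx' : ‖S' x'‖ ≤ ‖S' y₀‖ + K₁ := by
    have h1 := hK₁.dist_le_mul x' (hmem x' hx').2 y₀ (mem_of_mem_nhds hU)
    rw [dist_eq_norm, dist_eq_norm] at h1
    refine (norm_le_insert' _ (S' y₀)).trans (add_le_add le_rfl (h1.trans ?_))
    exact mul_le_of_le_one_right (by positivity) (hx'.trans (min_le_right _ _))
  have hlip := hK₁.dist_le_mul x (hmem x hx).2 x' (hmem x' hx').2
  rw [dist_eq_norm, dist_eq_norm] at hlip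
  have hsplit : S x (Q z) - S' x' (Q z') =
      (S x - S' x) (Q z) + (S' x - S' x') (Q z) + S' x' (Q (z - z')) := by
    simp [map_sub]
  have h1 : ‖(S x - S' x) (Q z)‖ ≤ c * ‖Q‖ * N * ‖x - y₀‖ ^ p := by
    calc _ ≤ ‖S x - S' x‖ * (‖Q‖ * ‖z‖) := (S x - S' x).le_opNorm_of_le (Q.le_opNorm z)
      _ ≤ (c * ‖x - y₀‖ ^ p) * (‖Q‖ * N) := by gcongr; exact (hmem x hx).1
      _ = _ := by ring
  have h2 : ‖(S' x - S' x') (Q z)‖ ≤ K₁ * ‖Q‖ * N * ‖x - x'‖ := by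
    calc _ ≤ ‖S' x - S' x'‖ * (‖Q‖ * ‖z‖) := (S' x - S' x').le_opNorm_of_le (Q.le_opNorm z)
      _ ≤ (K₁ * ‖x - x'‖) * (‖Q‖ * N) := by gcongr
      _ = _ := by ring
  have h3 : ‖S' x' (Q (z - z'))‖ ≤ (‖S' y₀‖ + K₁) * ‖Q‖ * ‖z - z'‖ := by
    calc _ ≤ ‖S' x'‖ * (‖Q‖ * ‖z - z'‖) := (S' x').le_opNorm_of_le (Q.le_opNorm _)
      _ ≤ (‖S' y₀‖ + K₁) * (‖Q‖ * ‖z - z'‖) := by gcongr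
      _ = _ := by ring
  rw [hsplit]
  refine (norm_add₃_le.trans (add_le_add (add_le_add h1 h2) h3)).trans ?_
  have e1 : 0 ≤ c * ‖Q‖ * N := by positivity
  have e2 : 0 ≤ K₁ * ‖Q‖ * N := by positivity
  have e3 : 0 ≤ (‖S' y₀‖ + K₁) * ‖Q‖ := by positivity
  have n1 : 0 ≤ ‖x - y₀‖ ^ p := by positivity
  have n2 := norm_nonneg (x - x')
  have n3 := norm_nonneg (z - z')
  linarith [mul_nonneg e1 n2, mul_nonneg e1 n3, mul_nonneg e2 n1, mul_nonneg e2 n3,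
    mul_nonneg e3 n1, mul_nonneg e3 n2]

end Extended

theorem eventually_mul_le (c : ℝ) {r : ℝ} (hr : 0 < r) : ∀ᶠ h : ℝ in 𝓝[>] 0, h * c ≤ r := by
  have : Tendsto (fun h : ℝ => h * c) (𝓝 0) (𝓝 0) := by
    simpa using (continuous_mul_const c).tendsto 0
  exact (this.eventually_le_const hr).filter_mono nhdsWithin_le_nhds

theorem eventually_nhdsGT_zero_iff {P : ℝ → Prop} :
    (∀ᶠ h in 𝓝[>] 0, P h) ↔ ∃ h₀ > 0, ∀ h, 0 < h → h < h₀ → P h := by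
  rw [Filter.Eventually, mem_nhdsGT_iff_exists_Ioo_subset]
  exact ⟨fun ⟨u, hu, h⟩ => ⟨u, hu, fun x h1 h2 => h ⟨h1, h2⟩⟩,
    fun ⟨u, hu, h⟩ => ⟨u, hu, fun x hx => h x hx.1 hx.2⟩⟩

section ExactStart

variable {d s : ℕ} {A : Matrix (Fin s) (Fin s) ℝ}

theorem abs_abscissa_le {α : ℝ} (hα : ∀ i, ∑ j, |A i j| ≤ α) (i : Fin s) : |abscissa A i| ≤ α :=
  (Finset.abs_sum_le_sum_abs _ _).trans (hα i)

theorem tendsto_abscissa_mul {a T : ℝ} (ha : a ≤ 0) (hT : 0 < T) {i : Fin s}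
    (hac : abscissa A i < 0 → a < 0) :
    Tendsto (fun h => abscissa A i * h) (𝓝[>] 0) (𝓝[Ico a T] 0) := by
  have h0 : Tendsto (fun h => abscissa A i * h) (𝓝[>] 0) (𝓝 0) := by
    have := (continuous_const_mul (abscissa A i)).tendsto 0
    rw [mul_zero] at this
    exact this.mono_left nhdsWithin_le_nhds
  refine tendsto_nhdsWithin_iff.2 ⟨h0, ?_⟩
  by_cases hi : abscissa A i < 0
  · filter_upwards [h0.eventually_const_lt (hac hi), h0.eventually_lt_const hT] with h h1 h2
    exact ⟨h1.le, h2⟩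
  · filter_upwards [self_mem_nhdsWithin, h0.eventually_lt_const hT] with h h1 h2
    exact ⟨ha.trans (mul_nonneg (not_lt.1 hi) (le_of_lt h1)), h2⟩

variable {b : Fin s → ℝ}
  {S : EuclideanSpace ℝ (Fin d) → EuclideanSpace ℝ (Fin d) →L[ℝ] EuclideanSpace ℝ (Fin d)}
  {V : EuclideanSpace ℝ (Fin d) → ℝ}
  {Q : EuclideanSpace ℝ (Fin d) →L[ℝ] EuclideanSpace ℝ (Fin d)}
  {y : ℝ → EuclideanSpace ℝ (Fin d)} {a T α : ℝ} {p : ℕ}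

theorem exists_eventually_norm_exactStage_sub_le {f : EuclideanSpace ℝ (Fin d) →
    EuclideanSpace ℝ (Fin d)} (ha : a ≤ 0) (hT : 0 < T) (hac : ∀ i, abscissa A i < 0 → a < 0)
    (hα : ∀ i, ∑ j, |A i j| ≤ α) (hy : IsSolutionOn f y (Ico a T)) :
    ∃ M, 0 ≤ M ∧ ∀ᶠ h in 𝓝[>] 0, ∀ i, ‖y (abscissa A i * h) - y 0‖ ≤ h * (M * α) := by
  obtain ⟨M, hM, hO⟩ := (hy 0 ⟨ha, hT⟩).isBigO_sub.exists_nonneg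
  have hO' : ∀ᶠ t in 𝓝[Ico a T] 0, ‖y t - y 0‖ ≤ M * |t| := by
    simpa [isBigOWith_iff, Function.comp_def] using hO
  refine ⟨M, hM, ?_⟩
  filter_upwards [eventually_all.2 fun i => (tendsto_abscissa_mul ha hT (hac i)).eventually hO',
    self_mem_nhdsWithin] with h h1 h2 i
  have h3 : (0 : ℝ) < h := h2
  refine (h1 i).trans ?_
  rw [abs_mul, abs_of_pos h3]
  calc M * (|abscissa A i| * h) ≤ M * (α * h) := by gcongr; exact abs_abscissa_le hα i
    _ = _ := by ring

/-- Started from the exact values `y (c_i h)`, the scheme has the order of its base method, for any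
number of iterations: it is the base method applied to the extended system, all of whose
components are solved by `y`. -/
theorem HasOrder.exists_eventually_exactStart (horder : HasOrder A b p) {L : ℝ≥0}
    (hLip : LipschitzWith L S) (hsmooth : ContDiff ℝ (p - 1 : ℕ) S)
    (hsmooth' : LocallyLipschitz (iteratedFDeriv ℝ (p - 1) S)) (hV : ∀ x, gradient V x = Q x)
    (ha : a ≤ 0) (hT : 0 < T) (hac : ∀ i, abscissa A i < 0 → a < 0)
    (hy : IsSolutionOn (fun x => S x (Q x)) y (Ico a T)) (m : ℕ) :
    ∃ M, ∀ᶠ h in 𝓝[>] 0, ∀ Z, IsSemiImplicitStages A S V (y 0) h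
        (explicitIterate A S V (y 0) h (fun i => y (abscissa A i * h)) m) Z →
      ‖semiImplicitOutput b S V (y 0) h
        (explicitIterate A S V (y 0) h (fun i => y (abscissa A i * h)) m) Z - y h‖ ≤
        M * h ^ (p + 1) := by
  obtain ⟨α, hα0, hαA, hαb⟩ := exists_isWeightBound A b
  have h0J : (0 : ℝ) ∈ Ico a T := ⟨ha, hT⟩
  have hyc : Tendsto y (𝓝[Ico a T] 0) (𝓝 (y 0)) := (hy 0 h0J).continuousWithinAt
  have hsubJ : Ico 0 T ⊆ Ico a T := Ico_subset_Ico_left ha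
  -- a smooth approximation `S'` of `S` and a smooth approximation `P` of the solution
  obtain ⟨S', hS', hSS'⟩ := exists_contDiff_sub_isBigO_pow hsmooth hsmooth' (y 0)
  -- for `p = 0` the truncated exponent `p - 1 + 1` is larger than `p`
  have hpow : (fun x : EuclideanSpace ℝ (Fin d) => ‖x - y 0‖ ^ (p - 1 + 1)) =O[𝓝 (y 0)]
      fun x => ‖x - y 0‖ ^ p := by
    refine .of_bound 1 ?_
    filter_upwards [Metric.closedBall_mem_nhds (y 0) one_pos] with x hx
    rw [norm_pow, norm_pow, norm_norm, one_mul]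
    exact pow_le_pow_of_le_one (norm_nonneg _) (mem_closedBall_iff_norm.1 hx) (by omega)
  obtain ⟨K, r, hK, hr, hSK⟩ := exists_norm_apply_sub_apply_le Q hS' (hSS'.trans hpow)
  have hfg : (fun x => S x (Q x) - S' x (Q x)) =O[𝓝 (y 0)] fun x => ‖x - y 0‖ ^ p := by
    refine .of_bound K ?_
    filter_upwards [Metric.closedBall_mem_nhds (y 0) hr] with x hx
    have hx' := mem_closedBall_iff_norm.1 hx
    simpa using hSK x x x x hx' hx' hx'
  obtain ⟨P, hP, hP0, hyP⟩ := exists_contDiff_curve_sub_isBigO_pow (g := fun x => S' x (Q x))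
    ordConnected_Ico h0J hy (hS'.clm_apply Q.contDiff) hfg
  obtain ⟨KP, hKP, hyPK⟩ := hyP.exists_nonneg
  have hyPK' : ∀ᶠ t in 𝓝[Ico a T] 0, ‖y t - P t‖ ≤ KP * |t| ^ p := by
    simpa [isBigOWith_iff] using hyPK
  have hball := Metric.closedBall_mem_nhds (y 0) hr
  have hPc : Tendsto P (𝓝[Ico a T] 0) (𝓝 (y 0)) := by
    rw [← hP0]; exact hP.continuous.continuousAt.tendsto.mono_left nhdsWithin_le_nhds
  have hyr : ∀ᶠ t in 𝓝[Ico a T] 0, ‖y t - y 0‖ ≤ r := by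
    filter_upwards [hyc hball] with t ht using mem_closedBall_iff_norm.1 ht
  have hPr : ∀ᶠ t in 𝓝[Ico a T] 0, ‖P t - y 0‖ ≤ r := by
    filter_upwards [hPc hball] with t ht using mem_closedBall_iff_norm.1 ht
  obtain ⟨My, hMy, hyM⟩ := (hy 0 h0J).isBigO_sub.exists_nonneg
  have hyM' : ∀ᶠ t in 𝓝[Ico a T] 0, ‖y t - y 0‖ ≤ My * |t| := by
    simpa [isBigOWith_iff, Function.comp_def] using hyM
  -- the curve `(t, y t, …, y t)` solves the extended system up to a defect `O (t ^ p)`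
  set G := extendedField (m := m) S' Q P
  set w : ℝ → ℝ × (Fin (m + 1) → EuclideanSpace ℝ (Fin d)) := fun t => (t, fun _ => y t) with hwdef
  set v : ℝ → ℝ × (Fin (m + 1) → EuclideanSpace ℝ (Fin d)) :=
    fun t => (1, fun _ => S (y t) (Q (y t))) with hvdef
  have hw : ∀ t ∈ Ico 0 T, HasDerivWithinAt w (v t) (Ico 0 T) t := fun t ht =>
    (hasDerivWithinAt_id t _).prodMk
      (hasDerivWithinAt_pi.2 fun _ => (hy t (hsubJ ht)).mono hsubJ)
  have hv : (fun t => v t - G (w t)) =O[𝓝[Ico 0 T] 0] fun t => t ^ p := by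
    refine IsBigO.mono (.of_bound (K * (My ^ p + KP + KP)) ?_) (nhdsWithin_mono 0 hsubJ)
    filter_upwards [hyPK', hyr, hPr, hyM'] with t h1 h2 h3 h4
    rw [norm_pow, Real.norm_eq_abs]
    refine (Prod.norm_def _).trans_le (max_le ?_ ?_)
    · simp only [hvdef, G, extendedField, Prod.fst_sub, sub_self, norm_zero]
      positivity
    refine (pi_norm_le_iff_of_nonneg (by positivity)).2 fun l => ?_
    have hfr : ‖y t - frozenArg (P t) (fun _ : Fin (m + 1) => y t) l‖ ≤ KP * |t| ^ p ∧
        ‖frozenArg (P t) (fun _ : Fin (m + 1) => y t) l - y 0‖ ≤ r := by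
      refine Fin.cases ⟨h1, h3⟩ (fun j => ⟨?_, h2⟩) l
      rw [frozenArg_succ, sub_self, norm_zero]
      positivity
    have hac : ‖y t - activeArg (P t) (fun _ : Fin (m + 1) => y t) l‖ ≤ KP * |t| ^ p := by
      unfold activeArg
      split_ifs
      · rw [sub_self, norm_zero]; positivity
      · exact hfr.1
    have := hSK (y t) _ (y t) (activeArg (P t) (fun _ : Fin (m + 1) => y t) l) h2 hfr.2 h2
    refine this.trans ?_
    calc _ ≤ K * ((My * |t|) ^ p + KP * |t| ^ p + KP * |t| ^ p) := by gcongr; exact hfr.1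
      _ = _ := by ring
  -- the stages of the scheme are perturbed stages of the extended system
  set F := (‖S (y 0)‖ + L * 1) * ‖Q‖ with hF
  have hF0 : 0 ≤ F := by positivity
  have hSF : ∀ x, ‖x - y 0‖ ≤ 1 → ‖S x‖ * ‖Q‖ ≤ F := fun x hx => norm_apply_mul_norm_le hLip hx
  set N := ‖y 0‖ + 1
  have hSN : ∀ x, ‖x - y 0‖ ≤ 1 → ‖S x (Q x)‖ ≤ F * N := fun x hx => by
    have hxN : ‖x‖ ≤ N := (norm_le_insert' x (y 0)).trans (by simp only [N]; gcongr)
    calc _ ≤ ‖S x‖ * (‖Q‖ * ‖x‖) := (S x).le_opNorm_of_le (Q.le_opNorm _)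
      _ = ‖S x‖ * ‖Q‖ * ‖x‖ := by ring
      _ ≤ _ := by gcongr; exact hSF x hx
  obtain ⟨M₀, hM₀, hstart⟩ := exists_eventually_norm_exactStage_sub_le ha hT hac hαA hy
  set M₁ := M₀ * α + α * (F * N) with hM₁
  have hM₁0 : 0 ≤ M₁ := by positivity
  set D := K * (M₁ ^ p + KP * α ^ p + KP * α ^ p) with hD
  obtain ⟨M, r', h₀, hr', hh₀, hM⟩ := horder.of_defect (contDiff_extendedField hS' Q hP) hT hw hv
    (D := D) (by positivity)
  refine ⟨M, ?_⟩
  have hcP := eventually_all.2 fun i =>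
    (tendsto_abscissa_mul ha hT (hac i)).eventually (hyPK'.and hPr)
  filter_upwards [hcP, hstart, eventually_mul_le M₁ one_pos, eventually_mul_le M₁ hr,
    eventually_mul_le M₁ hr', eventually_mul_le (α * F) (by norm_num : (0 : ℝ) < 1 / 2),
    eventually_mul_le (2 * α * F * ‖y 0‖) hr, eventually_mul_le (2 * α * F * ‖y 0‖) hr',
    eventually_mul_le α hr', Ioo_mem_nhdsGT hh₀]
    with h hcP hstart hs1 hsr hsr' hsF hZr hZr' hαr' ⟨hh0, hhh₀⟩ Z hZ
  set X := explicitIterate A S V (y 0) h (fun i => y (abscissa A i * h)) with hX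
  have hXM : ∀ l i, ‖X l i - y 0‖ ≤ h * M₁ :=
    norm_explicitIterate_sub_le hV hαA hh0.le (F := F * N) (by positivity)
      (fun x hx => hSN x (hx.trans hs1))
      (by rw [mul_assoc]; gcongr; rw [hM₁]; exact le_add_of_nonneg_left (by positivity))
      (fun i => (hstart i).trans (by
        gcongr; rw [hM₁]; exact le_add_of_nonneg_right (by positivity)))
  have hZM : ∀ i, ‖Z i - y 0‖ ≤ h * (2 * α * F * ‖y 0‖) :=
    norm_isSemiImplicitStages_sub_le hV hα0 hαA hh0.le hF0
      (fun j => hSF _ ((hXM m j).trans hs1)) (by rwa [mul_assoc]) hZ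
  set W : Fin s → ℝ × (Fin (m + 1) → EuclideanSpace ℝ (Fin d)) := fun i =>
    (abscissa A i * h, fun l => if l = Fin.last m then Z i else X (l + 1) i) with hW
  set φ : Fin s → ℝ × (Fin (m + 1) → EuclideanSpace ℝ (Fin d)) := fun j =>
    (1, fun l => S (X l j) (Q (if l = Fin.last m then Z j else X l j))) with hφ
  have hstage : ∀ i, W i = w 0 + h • ∑ j, A i j • φ j := fun i => by
    refine Prod.ext ?_ (funext fun l => ?_)
    · simp [hW, hwdef, hφ, Prod.fst_sum, abscissa, mul_comm]
    · simp only [hW, hwdef, hφ, Prod.snd_add, Prod.smul_snd, Prod.snd_sum, Pi.add_apply,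
        Pi.smul_apply, Finset.sum_apply]
      split_ifs with hl
      · rw [hl, Fin.val_last]
        have := hZ i
        simpa only [hV] using this
      · simp only [hX, explicitIterate, hV]
  have hnear : ∀ i, ‖W i - w 0‖ ≤ r' := fun i => by
    refine (Prod.norm_def _).trans_le (max_le ?_ ?_)
    · simp only [hW, hwdef, Prod.fst_sub, sub_zero, norm_mul, Real.norm_eq_abs, abs_of_pos hh0]
      refine le_trans ?_ hαr'
      rw [mul_comm]
      gcongr
      exact abs_abscissa_le hαA i
    · refine (pi_norm_le_iff_of_nonneg hr'.le).2 fun l => ?_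
      simp only [hW, hwdef, Prod.snd_sub, Pi.sub_apply]
      split_ifs
      · exact (hZM i).trans hZr'
      · exact (hXM _ i).trans hsr'
  have hslope : ∀ j, ‖φ j - G (W j)‖ ≤ D * h ^ p := fun j => by
    refine (Prod.norm_def _).trans_le (max_le ?_ ?_)
    · simp only [hφ, G, extendedField, Prod.fst_sub, sub_self, norm_zero]
      positivity
    refine (pi_norm_le_iff_of_nonneg (by positivity)).2 fun l => ?_
    have hP1 : ‖y (abscissa A j * h) - P (abscissa A j * h)‖ ≤ KP * α ^ p * h ^ p := by
      refine (hcP j).1.trans ?_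
      rw [mul_assoc, ← mul_pow, abs_mul, abs_of_pos hh0]
      gcongr
      exact abs_abscissa_le hαA j
    set u := (W j).2 with hu
    have hfr : ‖X l j - frozenArg (P (abscissa A j * h)) u l‖ ≤ KP * α ^ p * h ^ p := by
      rw [← dist_eq_norm]
      refine (dist_frozenArg_le (P (abscissa A j * h)) (fun l => X l j) (Z j) l).trans ?_
      rw [dist_eq_norm]
      exact hP1
    have hfr2 : ‖frozenArg (P (abscissa A j * h)) u l - y 0‖ ≤ r := by
      refine Fin.cases (hcP j).2 (fun i => ?_) l
      rw [frozenArg_succ, hu, hW]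
      simp only [if_neg (Fin.castSucc_lt_last i).ne]
      exact (hXM _ j).trans hsr
    have hac : ‖(if l = Fin.last m then Z j else X l j) -
        activeArg (P (abscissa A j * h)) u l‖ ≤ KP * α ^ p * h ^ p := by
      unfold activeArg
      split_ifs with hl
      · simp only [hu, hW, if_pos hl, sub_self, norm_zero]; positivity
      · exact hfr
    have hr2 : ‖(if l = Fin.last m then Z j else X l j) - y 0‖ ≤ r := by
      split_ifs
      · exact (hZM j).trans hZr
      · exact (hXM l j).trans hsr
    refine (hSK (X l j) _ _ (activeArg (P (abscissa A j * h)) u l) ((hXM l j).trans hsr) hfr2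
      hr2).trans ?_
    calc _ ≤ K * ((h * M₁) ^ p + KP * α ^ p * h ^ p + KP * α ^ p * h ^ p) := by
          gcongr; exact hXM l j
      _ = _ := by rw [hD, mul_pow]; ring
  have hfinal := hM h hh0 hhh₀ W φ hstage hnear hslope
  refine le_trans (le_of_eq_of_le ?_ ((norm_le_pi_norm _ (Fin.last m)).trans
    (norm_snd_le _))) hfinal
  simp [semiImplicitOutput, hV, hwdef, hφ, Prod.snd_sum]

end ExactStart

/-! ### Perturbed initial stages -/

section Accuracy

variable {d s : ℕ} {A : Matrix (Fin s) (Fin s) ℝ} {b : Fin s → ℝ}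
  {S : EuclideanSpace ℝ (Fin d) → EuclideanSpace ℝ (Fin d) →L[ℝ] EuclideanSpace ℝ (Fin d)}
  {V : EuclideanSpace ℝ (Fin d) → ℝ}
  {Q : EuclideanSpace ℝ (Fin d) →L[ℝ] EuclideanSpace ℝ (Fin d)}
  {y : ℝ → EuclideanSpace ℝ (Fin d)} {a T : ℝ} {p : ℕ}

/-- Each explicit iteration, and the semi-implicit step, gains one power of the step size in the
influence of the initial stages; so the scheme inherits the order of its exactly started version,
up to this influence. The constant does not depend on `q`. -/
theorem HasOrder.exists_eventually_explicitScheme (horder : HasOrder A b p) {L : ℝ≥0}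
    (hLip : LipschitzWith L S) (hsmooth : ContDiff ℝ (p - 1 : ℕ) S)
    (hsmooth' : LocallyLipschitz (iteratedFDeriv ℝ (p - 1) S)) (hV : ∀ x, gradient V x = Q x)
    (ha : a ≤ 0) (hT : 0 < T) (hac : ∀ i, abscissa A i < 0 → a < 0)
    (hy : IsSolutionOn (fun x => S x (Q x)) y (Ico a T)) (m : ℕ) (C : ℝ) :
    ∃ M, ∀ᶠ h in 𝓝[>] 0, ∀ (q : ℕ) (Y₀ : Fin s → EuclideanSpace ℝ (Fin d)),
      (∀ i, ‖Y₀ i - y (abscissa A i * h)‖ ≤ C * h ^ q) →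
      (∃! Z, IsSemiImplicitStages A S V (y 0) h (explicitIterate A S V (y 0) h Y₀ m) Z) ∧
      ∀ Z, IsSemiImplicitStages A S V (y 0) h (explicitIterate A S V (y 0) h Y₀ m) Z →
        ‖semiImplicitOutput b S V (y 0) h (explicitIterate A S V (y 0) h Y₀ m) Z - y h‖ ≤
          M * h ^ (min p (q + m) + 1) := by
  obtain ⟨α, hα0, hαA, hαb⟩ := exists_isWeightBound A b
  obtain ⟨M, hM⟩ := horder.exists_eventually_exactStart hLip hsmooth hsmooth' hV ha hT hac hy m
  obtain ⟨M₀, hM₀, hstart⟩ := exists_eventually_norm_exactStage_sub_le ha hT hac hαA hy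
  -- a radius that contains all iterates: `C * h ^ q ≤ |C|`, also for `q = 0`
  set R := |C| + 1
  set β := (‖S (y 0)‖ + L * R) * ‖Q‖
  set N := ‖y 0‖ + R
  set Λ := L * ‖Q‖ * N + β
  have hβ0 : 0 ≤ β := by positivity
  have hΛ0 : 0 ≤ Λ := by positivity
  have hN0 : 0 ≤ N := by positivity
  have hSβ : ∀ x, ‖x - y 0‖ ≤ R → ‖S x‖ * ‖Q‖ ≤ β := fun x hx => norm_apply_mul_norm_le hLip hx
  have hNorm : ∀ x, ‖x - y 0‖ ≤ R → ‖x‖ ≤ N := fun x hx =>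
    (norm_le_insert' x (y 0)).trans (add_le_add le_rfl hx)
  have hSN : ∀ x, ‖x - y 0‖ ≤ R → ‖S x (Q x)‖ ≤ β * N := fun x hx => by
    calc _ ≤ ‖S x‖ * (‖Q‖ * ‖x‖) := (S x).le_opNorm_of_le (Q.le_opNorm _)
      _ = ‖S x‖ * ‖Q‖ * ‖x‖ := by ring
      _ ≤ _ := by
        gcongr
        · exact hSβ x hx
        · exact hNorm x hx
  have hSΛ : ∀ x x', ‖x - y 0‖ ≤ R → ‖x' - y 0‖ ≤ R →
      ‖S x (Q x) - S x' (Q x')‖ ≤ Λ * ‖x - x'‖ := fun x x' hx hx' => by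
    refine (norm_apply_apply_sub_le hLip (hSβ x' hx') x x').trans ?_
    rw [← add_mul]
    gcongr
    exact add_le_add (by gcongr; exact hNorm x hx) le_rfl
  have hR1 : 1 ≤ R := le_add_of_nonneg_left (abs_nonneg C)
  refine ⟨2 * α * L * ‖Q‖ * N * ((α * Λ) ^ m * |C|) + |M|, ?_⟩
  filter_upwards [hM, hstart, eventually_mul_le (M₀ * α) one_pos,
    eventually_mul_le (α * (β * N)) (one_pos.trans_le hR1),
    eventually_mul_le (α * β) (by norm_num : (0 : ℝ) < 1 / 2),
    eventually_mul_le (2 * α * β * ‖y 0‖) (one_pos.trans_le hR1), Ioo_mem_nhdsGT one_pos]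
    with h hM hstart hs1 hsF hsβ hsZ ⟨hh0, hh1⟩ q Y₀ hY₀
  have hY₀' : ∀ i, ‖Y₀ i - y (abscissa A i * h)‖ ≤ |C| * h ^ q := fun i =>
    (hY₀ i).trans (by gcongr; exact le_abs_self C)
  have hY₀R : ∀ i, ‖Y₀ i - y 0‖ ≤ R := fun i => by
    have h1 : |C| * h ^ q ≤ |C| :=
      mul_le_of_le_one_right (abs_nonneg C) (pow_le_one₀ hh0.le hh1.le)
    exact (norm_sub_le_norm_sub_add_norm_sub _ _ _).trans
      (add_le_add ((hY₀' i).trans h1) ((hstart i).trans hs1))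
  have hX := norm_explicitIterate_sub_le (S := S) hV hαA hh0.le (by positivity) hSN
    (by rwa [mul_assoc]) hY₀R
  have hX' := norm_explicitIterate_sub_le (S := S) hV hαA hh0.le (by positivity) hSN
    (by rwa [mul_assoc]) fun i => ((hstart i).trans hs1).trans hR1
  have hhβ : h * α * β ≤ 1 / 2 := by rwa [mul_assoc]
  refine ⟨existsUnique_isSemiImplicitStages hV hαA hh0.le hβ0 (fun j => hSβ _ (hX m j)) hhβ,
    fun Z hZ => ?_⟩
  obtain ⟨Z', hZ', -⟩ := existsUnique_isSemiImplicitStages hV hαA hh0.le hβ0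
    (fun j => hSβ _ (hX' m j)) hhβ
  have hdiff := norm_explicitIterate_sub_explicitIterate_le (S := S) hV hα0 hαA hh0.le hΛ0
    (by positivity) hSΛ hY₀' hX hX' m
  have hZN : ∀ j, ‖Z j‖ ≤ N := fun j => hNorm _
    ((norm_isSemiImplicitStages_sub_le hV hα0 hαA hh0.le hβ0 (fun j => hSβ _ (hX m j)) hhβ hZ
      j).trans hsZ)
  have hout := norm_semiImplicitOutput_sub_le hV hLip hα0 hαA hαb hh0.le hβ0 (by positivity) hN0
    (fun j => hSβ _ (hX' m j)) hhβ hZ hZ' hdiff hZN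
  refine (norm_sub_le_norm_sub_add_norm_sub _ _ _).trans ((add_le_add hout (hM Z' hZ')).trans ?_)
  rw [add_mul]
  refine add_le_add ?_ ?_
  · calc _ = 2 * α * L * ‖Q‖ * N * ((α * Λ) ^ m * |C|) * h ^ (q + m + 1) := by
          rw [mul_assoc h, mul_pow h]; ring
      _ ≤ _ := by
        refine mul_le_mul_of_nonneg_left ?_ (by positivity)
        exact pow_le_pow_of_le_one hh0.le hh1.le (by omega)
  · refine mul_le_mul (le_abs_self M) ?_ (by positivity) (abs_nonneg M)
    exact pow_le_pow_of_le_one hh0.le hh1.le (by omega)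

end Accuracy

end QuadInv

/-- `S` and `Q` take values in the endomorphisms of `ℝ^d`, whose norm is the matrix 2-norm.
The solution lives on `[a, T)`; `a = 0` is allowed when all abscissae are nonnegative. -/
theorem mainTheorem3 (d s p k : ℕ) (hk : 1 ≤ k)
    (A : Matrix (Fin s) (Fin s) ℝ) (b : Fin s → ℝ)
    (horder : QuadInv.HasOrder A b p)
    (S : EuclideanSpace ℝ (Fin d) → EuclideanSpace ℝ (Fin d) →L[ℝ] EuclideanSpace ℝ (Fin d))
    (hskew : ∀ x, ContinuousLinearMap.adjoint (S x) = -S x)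
    (L : ℝ≥0) (hLip : LipschitzWith L S)
    (hsmooth : ContDiff ℝ (p - 1 : ℕ) S)
    (hsmooth' : LocallyLipschitz (iteratedFDeriv ℝ (p - 1) S))
    (Q : EuclideanSpace ℝ (Fin d) →L[ℝ] EuclideanSpace ℝ (Fin d))
    (hQ : IsSelfAdjoint Q)
    (y : ℝ → EuclideanSpace ℝ (Fin d)) (a T : ℝ) (ha : a ≤ 0) (hT : 0 < T)
    (hac : ∀ i, QuadInv.abscissa A i < 0 → a < 0)
    (hy : QuadInv.IsSolutionOn (fun x => S x (gradient (QuadInv.quadV Q) x)) y (Set.Ico a T))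
    (C : ℝ) :
    (∃ C' h₀ : ℝ, 0 < h₀ ∧ ∀ (q : ℕ) (h : ℝ), 0 < h → h < h₀ →
      ∀ Y₀ : Fin s → EuclideanSpace ℝ (Fin d),
        (∀ i, ‖Y₀ i - y (QuadInv.abscissa A i * h)‖ ≤ C * h ^ q) →
        (∃! Zy : (Fin s → EuclideanSpace ℝ (Fin d)) × EuclideanSpace ℝ (Fin d),
          QuadInv.IsExplicitScheme A b S (QuadInv.quadV Q) (y 0) h k Y₀ Zy.1 Zy.2) ∧
        ∀ Z y₁, QuadInv.IsExplicitScheme A b S (QuadInv.quadV Q) (y 0) h k Y₀ Z y₁ →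
          ‖y₁ - y h‖ ≤ C' * h ^ (min p (q + k - 1) + 1)) ∧
    (QuadInv.IsCanonical A b → ∀ (h : ℝ) (Y₀ Z : Fin s → EuclideanSpace ℝ (Fin d))
      (y₁ : EuclideanSpace ℝ (Fin d)),
      QuadInv.IsExplicitScheme A b S (QuadInv.quadV Q) (y 0) h k Y₀ Z y₁ →
        QuadInv.quadV Q y₁ = QuadInv.quadV Q (y 0)) := by
  have hV := QuadInv.gradient_quadV hQ
  obtain ⟨m, rfl⟩ : ∃ m, k = m + 1 := ⟨k - 1, by omega⟩
  refine ⟨?_, fun hcan h Y₀ Z y₁ hZ => ?_⟩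
  · simp only [hV] at hy
    obtain ⟨M, hM⟩ := horder.exists_eventually_explicitScheme hLip hsmooth hsmooth' hV ha hT hac hy
      m C
    obtain ⟨h₀, hh₀, hM⟩ := QuadInv.eventually_nhdsGT_zero_iff.1 hM
    refine ⟨M, h₀, hh₀, fun q h hh hhh₀ Y₀ hY₀ => ?_⟩
    obtain ⟨⟨Z, hZ, hZu⟩, hbound⟩ := hM h hh hhh₀ q Y₀ hY₀
    refine ⟨⟨(Z, QuadInv.semiImplicitOutput b S (QuadInv.quadV Q) (y 0) h
      (QuadInv.explicitIterate A S (QuadInv.quadV Q) (y 0) h Y₀ m) Z), ⟨hZ, rfl⟩, fun Zy hZy => ?_⟩,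
      fun Z y₁ hZ => ?_⟩
    · have h1 := hZu Zy.1 hZy.1
      exact Prod.ext h1 (by rw [hZy.2, h1]; rfl)
    · rw [hZ.2]
      exact hbound Z hZ.1
  · rw [hZ.2]
    exact QuadInv.quadV_semiImplicitOutput hcan hskew hQ hZ.1
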